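/- Let $\Gamma$ be a non-elementary (i.e. not virtually cyclic) torsion-free word-hyperbolic group. A one-edge splitting $\Theta$ of a group $G$ is an isomorphism of $G$ with an amalgamated product $A*_CB$ (vertex groups $A,B$, edge group $C$) or an HNN extension $A*_C$ (vertex group $A$, edge group $C$, stable letter $t$). It is non-trivial if $A\neq C\neq B$ in the amalgamated case (HNN extensions are always non-trivial), free if $C=1$, and essential cyclic if $C$ is cyclic and of infinite index in every vertex group. A subgroup is elliptic in $\Theta$ if it is conjugate into a vertex group. A homomorphism $h:G\to\Gamma$ is a witness for $\Theta$ if (1) $h$ is injective on the edge group $C$; (2) $h(G)$ is non-abelian; (3) if $C\neq 1$ and $A$ is any non-abelian vertex group, then $h(C)$ is non-central in $h(A)$; (4) if $\Theta$ is free, then the image of each vertex group and of each stable letter is non-trivial, and the image of each non-abelian vertex group is non-abelian. Suppose that $\Theta$ is a non-trivial one-edge free or essential cyclic splitting of $G$. (a) (With coefficients.) Let $G$ be generated by finite tuples $\underline{x}$ (variables) and $\underline{a}$ (coefficients), and assume that the coefficient subgroup $\langle\underline{a}\rangle$ is elliptic in $\Theta$. Let $\Lambda$ be a finite set of words in the free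 product of the free groups on the variables and on the coefficients. Suppose that there is a homomorphism $h:G\to\Gamma$ such that (i) $h$ is a witness for $\Theta$; (ii) $h$ maps $\langle\underline{a}\rangle$ onto $\Gamma$; (iii) $\lambda(h(\underline{x}),h(\underline{a}))\neq 1$ for all $\lambda\in\Lambda$. Regard the coefficients as elements of $\Gamma$ via $h$. Then there are infinitely many homomorphisms $f:G\to\Gamma$ that fix the coefficients, i.e. $f(a)=h(a)$ for each entry $a$ of $\underline{a}$, and satisfy $\lambda(f(\underline{x}),f(\underline{a}))\neq 1$ for all $\lambda\in\Lambda$. (b) (Without coefficients.) Let $G$ be generated by a finite tuple $\underline{x}$, and assume that $\Theta$ has at least one non-abelian vertex group. Let $\Lambda$ be a finite set of words in the free group on the variables. Suppose that there is a witness $h:G\to\Gamma$ for $\Theta$ such that $\lambda(h(\underline{x}))\neq 1$ for all $\lambda\in\Lambda$. Then the set of homomorphisms $f:G\to\Gamma$ with $\lambda(f(\underline{x}))\neq 1$ for all $\lambda\in\Lambda$ falls into infinitely many classes under conjugation by elements of $\Gamma$. -/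

import Mathlib

/-! ### Torsion-free hyperbolic groups -/

/-- The word length of `g` with respect to `S`: the least length of a word in the letters
`s` and `s⁻¹`, `s ∈ S`, that represents `g`. (It is only used when `S` generates.) -/
noncomputable def wordLength {Γ : Type*} [Group Γ] (S : Set Γ) (g : Γ) : ℕ :=
  sInf {n : ℕ | ∃ l : List Γ, l.length = n ∧ (∀ s ∈ l, s ∈ S ∨ s⁻¹ ∈ S) ∧ l.prod = g}

/-- The word metric of `Γ` with respect to `S`, which is left invariant. -/
noncomputable def wordDist {Γ : Type*} [Group Γ] (S : Set Γ) (g k : Γ) : ℕ :=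
  wordLength S (g⁻¹ * k)

/-- `Γ` is (word-)hyperbolic: it has a finite generating set whose word metric satisfies
Gromov's four-point inequality. -/
def IsHyperbolicGroup (Γ : Type*) [Group Γ] : Prop :=
  ∃ S : Set Γ, S.Finite ∧ Subgroup.closure S = ⊤ ∧
    ∃ δ : ℕ, ∀ x y z w : Γ,
      wordDist S x y + wordDist S z w ≤
        max (wordDist S x z + wordDist S y w) (wordDist S x w + wordDist S y z) + δ

/-- No non-trivial element has finite order. -/
def IsTorsionFreeGroup (Γ : Type*) [Group Γ] : Prop :=
  ∀ g : Γ, g ≠ 1 → ¬ IsOfFinOrder g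

/-- `Γ` is elementary if it is virtually cyclic. -/
def IsElementaryGroup (Γ : Type*) [Group Γ] : Prop :=
  ∃ H : Subgroup Γ, IsCyclic H ∧ H.FiniteIndex

/-- A subgroup is non-abelian if two of its elements do not commute. -/
def Subgroup.IsNonabelian {G : Type*} [Group G] (H : Subgroup G) : Prop :=
  ∃ x ∈ H, ∃ y ∈ H, x * y ≠ y * x

/-! ### One-edge splittings -/

/-- A decomposition `G = A *_C B`: subgroups `A = vertex false`, `B = vertex true` and a common
subgroup `C = edge` such that the canonical map from the amalgamated free product of `A` and `B`
over `C` to `G` is an isomorphism. -/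
structure AmalgamSplitting (G : Type*) [Group G] where
  vertex : Bool → Subgroup G
  edge : Subgroup G
  edge_le : ∀ i, edge ≤ vertex i
  bijective : Function.Bijective
    (Monoid.PushoutI.lift (φ := fun i => Subgroup.inclusion (edge_le i))
      (fun i => (vertex i).subtype) edge.subtype (fun _ => rfl))

/-- A decomposition `G = A *_C` as an HNN extension: a subgroup `A = vertex`, two subgroups
`C = edge` and `C' = edge'` of `A`, an isomorphism `φ : C ≃ C'` and a stable letter `t` in `G` with
`t c t⁻¹ = φ c` for `c` in `C`, such that the canonical map from the HNN extension to `G` is an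
isomorphism. -/
structure HNNSplitting (G : Type*) [Group G] where
  vertex : Subgroup G
  edge : Subgroup vertex
  edge' : Subgroup vertex
  φ : edge ≃* edge'
  t : G
  conj : ∀ c : edge, t * vertex.subtype c = vertex.subtype (φ c) * t
  bijective : Function.Bijective (HNNExtension.lift (φ := φ) vertex.subtype t conj)

/-- A one-edge splitting of `G`: an amalgamated free product or an HNN extension. -/
inductive OneEdgeSplitting (G : Type*) [Group G]
  | amalgam (S : AmalgamSplitting G)
  | hnn (S : HNNSplitting G)

namespace OneEdgeSplitting

variable {G : Type*} [Group G]

/-- The vertex groups: `A` and `B` for `A *_C B`, and `A` for `A *_C`. -/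
def vertexGroups : OneEdgeSplitting G → Set (Subgroup G)
  | amalgam S => Set.range S.vertex
  | hnn S => {S.vertex}

/-- The edge group `C`. -/
def edgeGroup : OneEdgeSplitting G → Subgroup G
  | amalgam S => S.edge
  | hnn S => S.edge.map S.vertex.subtype

/-- The stable letter `t` of `A *_C`; there is none for `A *_C B`. -/
def stableLetters : OneEdgeSplitting G → Set G
  | amalgam _ => ∅
  | hnn S => {S.t}

/-- The splitting is non-trivial: no vertex group is all of `G`, i.e. `A ≠ C ≠ B` in
`A *_C B`; an HNN extension is always non-trivial. -/
def IsNontrivial : OneEdgeSplitting G → Prop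
  | amalgam S => ∀ i, S.vertex i ≠ S.edge
  | hnn _ => True

/-- A free splitting: the edge group is trivial. -/
def IsFree (Θ : OneEdgeSplitting G) : Prop :=
  Θ.edgeGroup = ⊥

/-- The edge group has infinite index in any vertex group (under each of its two embeddings);
`relIndex` is `0` when the index is infinite. -/
def IsEssential : OneEdgeSplitting G → Prop
  | amalgam S => ∀ i, S.edge.relIndex (S.vertex i) = 0
  | hnn S => S.edge.index = 0 ∧ S.edge'.index = 0

/-- An essential cyclic splitting. -/
def IsEssentialCyclic (Θ : OneEdgeSplitting G) : Prop :=
  IsCyclic Θ.edgeGroup ∧ Θ.IsEssential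

/-- The subgroup `K` is elliptic (it fixes a vertex of the Bass-Serre tree): it is contained in
a conjugate of a vertex group. -/
def IsElliptic (Θ : OneEdgeSplitting G) (K : Subgroup G) : Prop :=
  ∃ V ∈ Θ.vertexGroups, ∃ g : G, K ≤ V.map (MulAut.conj g).toMonoidHom

/-- The homomorphism `h` is a witness with respect to the splitting `Θ`. -/
structure IsWitness (Θ : OneEdgeSplitting G) {Γ : Type*} [Group Γ] (h : G →* Γ) : Prop where
  /-- `h` is injective on the edge group -/
  injOn_edge : Set.InjOn h Θ.edgeGroup
  /-- `h(G)` is non-abelian -/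
  range_nonabelian : h.range.IsNonabelian
  /-- `h(C)` is non-central in `h(A)` for each non-abelian vertex group `A`, if `C` is
  non-trivial -/
  edge_noncentral : ∀ A ∈ Θ.vertexGroups, A.IsNonabelian → Θ.edgeGroup ≠ ⊥ →
    ∃ c ∈ Θ.edgeGroup, ∃ a ∈ A, h c * h a ≠ h a * h c
  /-- in a free splitting, vertex groups have non-trivial image -/
  vertex_nontrivial : Θ.IsFree → ∀ A ∈ Θ.vertexGroups, A.map h ≠ ⊥
  /-- in a free splitting, the stable letter (if any) has non-trivial image -/
  stable_nontrivial : Θ.IsFree → ∀ t ∈ Θ.stableLetters, h t ≠ 1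
  /-- in a free splitting, non-abelian vertex groups have non-abelian image -/
  vertex_nonabelian : Θ.IsFree → ∀ A ∈ Θ.vertexGroups, A.IsNonabelian → (A.map h).IsNonabelian

end OneEdgeSplitting

/-! ### Inequations and homomorphisms -/

open scoped Monoid.Coprod in
/-- The value `w(g, b)` of a word `w` in variables (indexed by `ι`) and coefficients
(indexed by `κ`). -/
def evalWord {H ι κ : Type*} [Group H] (g : ι → H) (b : κ → H)
    (w : FreeGroup ι ∗ FreeGroup κ) : H :=
  Monoid.Coprod.lift (FreeGroup.lift g) (FreeGroup.lift b) w

open scoped Monoid.Coprod in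
/-- `IHom_Γ(G, Γ; Λ)`: here `x` and `a` are the variables and the coefficients in `G`, and `α` are
the corresponding coefficients in `Γ`. It consists of the homomorphisms `f : G → Γ` that
fix the coefficients, `f (a k) = α k`, and satisfy all inequations `λ(f(x), f(a)) ≠ 1`,
`λ ∈ Λ`. -/
def IHomCoeff {G Γ ι κ : Type*} [Group G] [Group Γ] (x : ι → G) (a : κ → G) (α : κ → Γ)
    (Λ : Set (FreeGroup ι ∗ FreeGroup κ)) : Set (G →* Γ) :=
  {f | (∀ k, f (a k) = α k) ∧ ∀ w ∈ Λ, evalWord (fun i => f (x i)) (fun k => f (a k)) w ≠ 1}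

/-- `IHom(G, Γ; Λ)`: the homomorphisms `f : G → Γ` that satisfy all the
coefficient-free inequations `λ(f(x)) ≠ 1`, `λ ∈ Λ`. -/
def IHom {G ι : Type*} [Group G] (Γ : Type*) [Group Γ] (x : ι → G) (Λ : Set (FreeGroup ι)) :
    Set (G →* Γ) :=
  {f | ∀ w ∈ Λ, FreeGroup.lift (fun i => f (x i)) w ≠ 1}

/-- Two elements of `IHom(G, Γ; Λ)` are equivalent if they differ by conjugation in `Γ`. -/
def IHom.conjSetoid {G ι : Type*} [Group G] (Γ : Type*) [Group Γ] (x : ι → G)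
    (Λ : Set (FreeGroup ι)) : Setoid (IHom Γ x Λ) where
  r f f' := ∃ γ : Γ, ∀ g : G, f'.1 g = γ * f.1 g * γ⁻¹
  iseqv :=
    { refl := fun f => ⟨1, fun g => by simp⟩
      symm := by
        rintro f f' ⟨γ, hγ⟩
        exact ⟨γ⁻¹, fun g => by rw [hγ g]; group⟩
      trans := by
        rintro f f' f'' ⟨γ, hγ⟩ ⟨γ', hγ'⟩
        exact ⟨γ' * γ, fun g => by rw [hγ' g, hγ g]; group⟩ }

/-- `𝒪(G, Γ; Λ) = IHom(G, Γ; Λ) / Γ`, the set of conjugacy classes. -/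
def IHomClasses {G ι : Type*} [Group G] (Γ : Type*) [Group Γ] (x : ι → G)
    (Λ : Set (FreeGroup ι)) : Type _ :=
  Quotient (IHom.conjSetoid Γ x Λ)

/-! The given `h` is deformed by twisting along the edge group `C`. Fix a vertex group `V` and some
`z ≠ 1` in `Γ` commuting with `h(C)`. Keep `h` on `V`, and replace `h(t)` by `h(t) z ^ n`, or
conjugate `h` by `z ^ n` on the other vertex group `W`, or, for non-trivial `C` and abelian `W`,
multiply `h(w)` by `z ^ (n p(w))` with `p : W → ℤ` non-trivial and killing `C`. Taking all `n`
together gives one homomorphism from `G` to `powerFunctions z`, whose value at `n = 0` is `h`. The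
choices of `z` and `p` in `exists_twistSequence` make the twists pairwise distinct.

Inequations survive for large `n` by a big powers argument, `IsHyperbolicLength.eventually_ne_one`:
a function of `n` built from constants and `z ^ n` is either constant or of length tending to
infinity. This rests on `exists_bound_of_not_commute`: in `z ^ j * u * z ^ k` there is only bounded
cancellation unless `u` commutes with `z`. The geometric input is that powers of `z` are
quasi-geodesic (`isQuasiAdditive`), combined with pigeonhole arguments in finite balls.

With coefficients, `V` contains the coefficient group up to conjugacy, and an inner automorphism
depending on `n` makes the twists fix the coefficients. Without coefficients, `V` is taken
non-abelian; then `h(V)` has trivial centralizer, so distinct twists are not conjugate. -/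

/-! ### Word length as a hyperbolic length function -/

section WordLength

variable {Γ : Type*} [Group Γ]

/-- An integral length function on a group that behaves like the word length of a
hyperbolic group: the associated left-invariant metric is proper, geodesic and satisfies Gromov's
four-point inequality. -/
structure IsHyperbolicLength (ℓ : Γ → ℕ) (δ : ℕ) : Prop where
  one : ℓ 1 = 0
  inv : ∀ g, ℓ g⁻¹ = ℓ g
  mul_le : ∀ g h, ℓ (g * h) ≤ ℓ g + ℓ h
  finite_ball : ∀ n, {g | ℓ g ≤ n}.Finite
  exists_split : ∀ g r, r ≤ ℓ g → ∃ p, ℓ p = r ∧ ℓ p + ℓ (p⁻¹ * g) = ℓ g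
  four_point : ∀ x y z w,
    ℓ (x⁻¹ * y) + ℓ (z⁻¹ * w) ≤ ℓ (x⁻¹ * z) + ℓ (y⁻¹ * w) + δ ∨
      ℓ (x⁻¹ * y) + ℓ (z⁻¹ * w) ≤ ℓ (x⁻¹ * w) + ℓ (y⁻¹ * z) + δ

theorem wordLength_prod_le (S : Set Γ) (l : List Γ) (hl : ∀ s ∈ l, s ∈ S ∨ s⁻¹ ∈ S) :
    wordLength S l.prod ≤ l.length :=
  Nat.sInf_le ⟨l, rfl, hl, rfl⟩

theorem exists_word_of_closure_eq_top {S : Set Γ} (hS : Subgroup.closure S = ⊤) (g : Γ) :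
    ∃ l : List Γ, l.length = wordLength S g ∧ (∀ s ∈ l, s ∈ S ∨ s⁻¹ ∈ S) ∧ l.prod = g := by
  have hg : g ∈ Subgroup.closure S := hS ▸ Subgroup.mem_top g
  rw [← Subgroup.mem_toSubmonoid, Subgroup.closure_toSubmonoid] at hg
  obtain ⟨l, hl, hp⟩ := Submonoid.exists_list_of_mem_closure hg
  exact Nat.sInf_mem (s := {n : ℕ | ∃ l : List Γ, l.length = n ∧
    (∀ s ∈ l, s ∈ S ∨ s⁻¹ ∈ S) ∧ l.prod = g}) ⟨_, l, rfl, hl, hp⟩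

theorem wordLength_mul_le {S : Set Γ} (hS : Subgroup.closure S = ⊤) (g k : Γ) :
    wordLength S (g * k) ≤ wordLength S g + wordLength S k := by
  obtain ⟨l, h1, h2, h3⟩ := exists_word_of_closure_eq_top hS g
  obtain ⟨l', h1', h2', h3'⟩ := exists_word_of_closure_eq_top hS k
  have := wordLength_prod_le S (l ++ l') (by
    intro s hs
    rcases List.mem_append.1 hs with h | h
    exacts [h2 s h, h2' s h])
  rw [List.prod_append, h3, h3', List.length_append, h1, h1'] at this
  exact this

theorem wordLength_inv_le {S : Set Γ} (hS : Subgroup.closure S = ⊤) (g : Γ) :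
    wordLength S g⁻¹ ≤ wordLength S g := by
  obtain ⟨l, h1, h2, h3⟩ := exists_word_of_closure_eq_top hS g
  have := wordLength_prod_le S (l.map fun x => x⁻¹).reverse (by
    intro s hs
    simp only [List.mem_reverse, List.mem_map] at hs
    obtain ⟨x, hx, rfl⟩ := hs
    rw [inv_inv]
    exact (h2 x hx).symm)
  rwa [← List.prod_inv_reverse, h3, List.length_reverse, List.length_map, h1] at this

theorem wordLength_one (S : Set Γ) : wordLength S (1 : Γ) = 0 :=
  Nat.le_zero.1 (wordLength_prod_le S [] (by simp))

theorem finite_wordLength_le {S : Set Γ} (hfin : S.Finite) (hS : Subgroup.closure S = ⊤) (n : ℕ) :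
    {g : Γ | wordLength S g ≤ n}.Finite := by
  classical
  have hT : (S ∪ S⁻¹).Finite := hfin.union hfin.inv
  induction n with
  | zero =>
    refine (Set.finite_singleton (1 : Γ)).subset fun g hg => ?_
    obtain ⟨l, h1, -, h3⟩ := exists_word_of_closure_eq_top hS g
    have h0 : l = [] := List.length_eq_zero_iff.1 (h1.trans (Nat.le_zero.1 hg))
    subst h0
    exact h3.symm
  | succ n ih =>
    refine ((Set.finite_singleton (1 : Γ)).union (hT.image2 (· * ·) ih)).subset fun g hg => ?_
    obtain ⟨l, h1, h2, h3⟩ := exists_word_of_closure_eq_top hS g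
    cases l with
    | nil => exact Or.inl h3.symm
    | cons s l =>
      refine Or.inr ⟨s, h2 s (by simp), l.prod, ?_, by simpa using h3⟩
      have h4 := wordLength_prod_le S l fun x hx => h2 x (by simp [hx])
      have h5 : wordLength S g ≤ n + 1 := hg
      simp only [List.length_cons] at h1
      simp only [Set.mem_ofPred_eq]
      omega

theorem wordLength_exists_split {S : Set Γ} (hS : Subgroup.closure S = ⊤) (g : Γ) (r : ℕ)
    (hr : r ≤ wordLength S g) :
    ∃ p, wordLength S p = r ∧ wordLength S p + wordLength S (p⁻¹ * g) = wordLength S g := by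
  obtain ⟨l, h1, h2, h3⟩ := exists_word_of_closure_eq_top hS g
  have ha := wordLength_prod_le S (l.take r) fun x hx => h2 x (List.mem_of_mem_take hx)
  have hb := wordLength_prod_le S (l.drop r) fun x hx => h2 x (List.mem_of_mem_drop hx)
  have hp : (l.take r).prod * (l.drop r).prod = g := by rw [List.prod_take_mul_prod_drop, h3]
  have hq : (l.take r).prod⁻¹ * g = (l.drop r).prod := by rw [← hp]; group
  have hc := wordLength_mul_le hS (l.take r).prod (l.drop r).prod
  rw [hp] at hc
  rw [List.length_take] at ha
  rw [List.length_drop] at hb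
  refine ⟨(l.take r).prod, ?_, ?_⟩
  · omega
  · rw [hq]; omega

theorem IsHyperbolicGroup.exists_length (hyp : IsHyperbolicGroup Γ) :
    ∃ (ℓ : Γ → ℕ) (δ : ℕ), IsHyperbolicLength ℓ δ := by
  obtain ⟨S, hfin, hS, δ, hδ⟩ := hyp
  refine ⟨wordLength S, δ, wordLength_one S, fun g => le_antisymm (wordLength_inv_le hS g) ?_,
    wordLength_mul_le hS, finite_wordLength_le hfin hS, wordLength_exists_split hS, ?_⟩
  · simpa using wordLength_inv_le hS g⁻¹
  · intro x y z w
    have := hδ x y z w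
    simp only [wordDist] at this
    omega

end WordLength

/-! ### Powers of elements of infinite order are quasi-geodesic -/

/-- The length function is coarsely additive along the positive powers of `z`. -/
def IsQuasiAdditive {Γ : Type*} [Group Γ] (ℓ : Γ → ℕ) (z : Γ) : Prop :=
  ∃ D : ℕ, ∀ a b : ℕ, ℓ (z ^ a) + ℓ (z ^ b) ≤ ℓ (z ^ (a + b)) + D

namespace IsHyperbolicLength

variable {Γ : Type*} [Group Γ] {ℓ : Γ → ℕ} {δ : ℕ}

theorem le_mul_left (H : IsHyperbolicLength ℓ δ) (g k : Γ) : ℓ k ≤ ℓ g + ℓ (g * k) := by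
  have := H.mul_le g⁻¹ (g * k)
  rwa [inv_mul_cancel_left, H.inv] at this

theorem le_mul_right (H : IsHyperbolicLength ℓ δ) (g k : Γ) : ℓ g ≤ ℓ (g * k) + ℓ k := by
  have := H.mul_le (g * k) k⁻¹
  rwa [mul_inv_cancel_right, H.inv] at this

theorem pow_le (H : IsHyperbolicLength ℓ δ) (g : Γ) (n : ℕ) : ℓ (g ^ n) ≤ n * ℓ g := by
  induction n with
  | zero => simp [H.one]
  | succ n ih =>
    rw [pow_succ, add_mul, one_mul]
    exact (H.mul_le _ _).trans (by omega)

/-- An injective sequence leaves every ball. -/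
theorem eventually_lt (H : IsHyperbolicLength ℓ δ) {f : ℕ → Γ} (hf : Function.Injective f)
    (B : ℕ) : ∀ᶠ n in Filter.atTop, B < ℓ (f n) := by
  have hfin : (f ⁻¹' {g | ℓ g ≤ B}).Finite := (H.finite_ball B).preimage hf.injOn
  have := hfin.compl_mem_cofinite
  rw [Nat.cofinite_eq_atTop] at this
  filter_upwards [this] with n hn
  simpa using hn

theorem pow_conj (p z : Γ) (n : ℕ) : (p⁻¹ * z * p) ^ n = p⁻¹ * z ^ n * p := by
  have := conj_pow (i := n) (a := p⁻¹) (b := z)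
  rwa [inv_inv] at this

theorem quasiAdditive_of_conj (H : IsHyperbolicLength ℓ δ) {p z : Γ}
    (h : IsQuasiAdditive ℓ (p⁻¹ * z * p)) : IsQuasiAdditive ℓ z := by
  obtain ⟨D, hD⟩ := h
  have h1 : ∀ n, ℓ (z ^ n) ≤ ℓ ((p⁻¹ * z * p) ^ n) + 2 * ℓ p := fun n => by
    have e : z ^ n = p * (p⁻¹ * z * p) ^ n * p⁻¹ := by rw [pow_conj]; group
    have h1 := H.mul_le (p * (p⁻¹ * z * p) ^ n) p⁻¹
    have h2 := H.mul_le p ((p⁻¹ * z * p) ^ n)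
    rw [← e, H.inv] at h1
    omega
  have h2 : ∀ n, ℓ ((p⁻¹ * z * p) ^ n) ≤ ℓ (z ^ n) + 2 * ℓ p := fun n => by
    have h1 := H.mul_le (p⁻¹ * z ^ n) p
    have h2 := H.mul_le p⁻¹ (z ^ n)
    rw [H.inv] at h2
    rw [pow_conj]
    omega
  refine ⟨D + 6 * ℓ p, fun a b => ?_⟩
  have := hD a b
  have := h1 a
  have := h1 b
  have := h2 (a + b)
  omega

/-- Division with remainder replaces `z ^ a` by a power of `z ^ J` at the cost of at most `J * ℓ z`.
-/
theorem quasiAdditive_of_pow (H : IsHyperbolicLength ℓ δ) {z : Γ} {J : ℕ} (hJ : 0 < J)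
    (h : IsQuasiAdditive ℓ (z ^ J)) : IsQuasiAdditive ℓ z := by
  obtain ⟨D, hD⟩ := h
  have hr : ∀ a, ℓ (z ^ (a % J)) ≤ J * ℓ z := fun a =>
    (H.pow_le z _).trans (Nat.mul_le_mul_right _ (Nat.mod_lt _ hJ).le)
  have e : ∀ a, z ^ a = (z ^ J) ^ (a / J) * z ^ (a % J) := fun a => by
    rw [← pow_mul, ← pow_add, Nat.div_add_mod]
  have h1 : ∀ a, ℓ (z ^ a) ≤ ℓ ((z ^ J) ^ (a / J)) + J * ℓ z := fun a => by
    have h1 := H.mul_le ((z ^ J) ^ (a / J)) (z ^ (a % J))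
    rw [← e] at h1
    have := hr a
    omega
  refine ⟨D + 4 * (J * ℓ z), fun a b => ?_⟩
  have e2 : z ^ (a + b) = (z ^ J) ^ (a / J + b / J) * (z ^ (a % J) * z ^ (b % J)) := by
    rw [pow_add z a b, e a, e b, pow_add]
    simp only [← pow_mul, ← pow_add]
    congr 1
    ring
  have h2 := H.le_mul_right ((z ^ J) ^ (a / J + b / J)) (z ^ (a % J) * z ^ (b % J))
  rw [← e2] at h2
  have h3 := H.mul_le (z ^ (a % J)) (z ^ (b % J))
  have := hD (a / J) (b / J)
  have := h1 a
  have := h1 b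
  have := hr a
  have := hr b
  omega

/-- Local-to-global: if `g²` is sufficiently longer than `g`, then the powers of `g` form a
quasi-geodesic. -/
theorem quasiAdditive_of_sq (H : IsHyperbolicLength ℓ δ) {g : Γ}
    (hg : ℓ g + 2 * δ + 1 ≤ ℓ (g ^ 2)) : IsQuasiAdditive ℓ g := by
  have hsq : ℓ (g ^ 2) ≤ 2 * ℓ g := H.pow_le g 2
  have fp : ∀ a b c : ℕ, ℓ (g ^ (a + b)) + ℓ (g ^ (b + c)) ≤ ℓ (g ^ (a + b + c)) + ℓ (g ^ b) + δ ∨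
      ℓ (g ^ (a + b)) + ℓ (g ^ (b + c)) ≤ ℓ (g ^ a) + ℓ (g ^ c) + δ := fun a b c => by
    have := H.four_point 1 (g ^ (a + b)) (g ^ a) (g ^ (a + b + c))
    have e1 : (1 : Γ)⁻¹ * g ^ (a + b) = g ^ (a + b) := by simp
    have e2 : (g ^ a)⁻¹ * g ^ (a + b + c) = g ^ (b + c) := by
      rw [add_assoc, pow_add]; group
    have e3 : (1 : Γ)⁻¹ * g ^ a = g ^ a := by simp
    have e4 : (g ^ (a + b))⁻¹ * g ^ (a + b + c) = g ^ c := by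
      rw [pow_add _ (a + b)]; group
    have e5 : (1 : Γ)⁻¹ * g ^ (a + b + c) = g ^ (a + b + c) := by simp
    have e6 : (g ^ (a + b))⁻¹ * g ^ a = (g ^ b)⁻¹ := by rw [pow_add]; group
    rw [e1, e2, e3, e4, e5, e6, H.inv] at this
    omega
  -- Each further factor `g` gains at least `δ + 1` in length. In the induction, the other
  -- four-point alternative would force `ℓ (g ^ 2) ≤ ℓ g + δ`. The same gain later rules out the bad
  -- alternative for general `a`, `b`.
  have step : ∀ n : ℕ, ℓ (g ^ n) + ℓ (g ^ 2) ≤ ℓ (g ^ (n + 1)) + ℓ g + δ := fun n => by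
    induction n with
    | zero => simp [H.one]; omega
    | succ n ih =>
      have := fp n 1 1
      rw [pow_one] at this
      simp only [Nat.reduceAdd] at this
      omega
  refine ⟨2 * ℓ g + 2 * δ, fun a b => ?_⟩
  rcases a with - | a
  · simp only [pow_zero, H.one, zero_add]; omega
  rcases b with - | b
  · simp only [pow_zero, H.one, add_zero]; omega
  have h1 := fp a 1 b
  have h2 := fp (a + 1) 1 b
  have h3 := step a
  have h4 := step b
  have h5 := fp a 1 1
  have e : a + 1 + (b + 1) = a + 1 + 1 + b := by ring
  have h6 := step (a + 1)
  rw [e]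
  rw [pow_one] at h1 h2 h5
  rw [add_comm 1 b] at h1 h2
  simp only [Nat.reduceAdd] at h5
  omega

/-- If `u` commutes with `x`, is short, and `p` lies near the middle of a geodesic from `1` to `x`,
then `u * p` is near the same geodesic; the estimates locate its position. -/
theorem shift (H : IsHyperbolicLength ℓ δ) {x u p : Γ} (hc : Commute u x) {e : ℕ}
    (hp : ℓ p + ℓ (p⁻¹ * x) ≤ ℓ x + e) (h1 : 2 * ℓ u + e + δ < 2 * ℓ p)
    (h2 : 2 * ℓ u + e + δ < 2 * ℓ (p⁻¹ * x)) :
    ℓ (u * p) + ℓ x ≤ ℓ (u * x) + ℓ p + δ ∧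
      ℓ ((u * p)⁻¹ * x) + ℓ x ≤ ℓ (u⁻¹ * x) + ℓ (p⁻¹ * x) + δ ∧
      ℓ (u * x) + ℓ (u⁻¹ * x) ≤ 2 * ℓ x + δ := by
  have hx := H.mul_le p (p⁻¹ * x)
  rw [mul_inv_cancel_left] at hx
  have a1 := H.four_point 1 (u * p) u (u * x)
  have a2 := H.four_point (u * p) x u (u * x)
  have a3 := H.four_point 1 (u * x) u x
  have e1 : (u * p)⁻¹ * (u * x) = p⁻¹ * x := by group
  have e2 : (u * p)⁻¹ * u = p⁻¹ := by group
  have e3 : u⁻¹ * (u * x) = x := by group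
  have e4 : x⁻¹ * (u * x) = u := by rw [hc.eq]; group
  have e5 : (u * x)⁻¹ * x = u⁻¹ := by rw [hc.eq]; group
  have e6 : (u * x)⁻¹ * u = (u⁻¹ * (u * x))⁻¹ := by group
  have e7 : x⁻¹ * u = (u⁻¹ * x)⁻¹ := by group
  have b1 := H.le_mul_left u p
  have b2 : p⁻¹ * x = (u * p)⁻¹ * x * u := by
    rw [mul_assoc, ← hc.eq]; group
  have b3 := H.mul_le ((u * p)⁻¹ * x) u
  rw [← b2] at b3
  simp only [e1, e2, e3, e4, e5, e6, e7, H.inv, inv_one, one_mul] at a1 a2 a3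
  omega

end IsHyperbolicLength

namespace IsHyperbolicLength

variable {Γ : Type*} [Group Γ] {ℓ : Γ → ℕ} {δ : ℕ}

/-- Among many distinct elements there is one outside a given ball. -/
theorem exists_lt_of_injective (H : IsHyperbolicLength ℓ δ) (B : ℕ) :
    ∃ N : ℕ, ∀ f : ℕ → Γ, Set.InjOn f (Set.Iic N) → ∃ j ≤ N, B < ℓ (f j) := by
  refine ⟨(H.finite_ball B).toFinset.card, fun f hf => ?_⟩
  by_contra! hcon
  have := Finset.card_le_card_of_injOn (s := Finset.Iic (H.finite_ball B).toFinset.card)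
    (t := (H.finite_ball B).toFinset) f (fun j hj => by simpa using hcon j (by simpa using hj))
    (by simpa using hf)
  simp at this

/-- Conjugation by the midpoint `p` of a geodesic from `1` to a long power of `z` moves the base
point near the axis of `z`. There `u = z ^ j` and `u⁻¹` shift `p` along the geodesic in opposite
directions, so `u⁻¹ * p` and `u * p` are almost twice as far apart as `p` and `u * p`. -/
theorem exists_conj_pow_sq (H : IsHyperbolicLength ℓ δ) {z : Γ}
    (hz : Function.Injective fun n : ℕ => z ^ n) :
    ∃ J : ℕ, 0 < J ∧ ∃ p : Γ,
      ℓ (p⁻¹ * z ^ J * p) + 2 * δ + 1 ≤ ℓ ((p⁻¹ * z ^ J * p) ^ 2) := by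
  -- `N` depends only on the size of a ball, so it can be fixed before `m` and `p`; all `z ^ j` with
  -- `j ≤ N` are then short compared with `z ^ m`.
  obtain ⟨N, hN⟩ := H.exists_lt_of_injective (13 * δ + 1)
  obtain ⟨m, hm⟩ := (H.eventually_lt hz (4 * (N * ℓ z) + 2 * δ + 10)).exists
  obtain ⟨p, hp1, hp2⟩ := H.exists_split (z ^ m) (ℓ (z ^ m) / 2) (Nat.div_le_self _ _)
  obtain ⟨j, hjN, hj⟩ := hN (fun j => p⁻¹ * z ^ j * p) fun a _ b _ hab => hz (by simpa using hab)
  have hj0 : 0 < j := Nat.pos_of_ne_zero fun h => by simp [h, H.one] at hj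
  refine ⟨j, hj0, p, ?_⟩
  have hu : ℓ (z ^ j) ≤ N * ℓ z := (H.pow_le z j).trans (Nat.mul_le_mul_right _ hjN)
  rw [pow_conj]
  set u := z ^ j
  set x := z ^ m
  have hc : Commute u x := Commute.pow_pow_self z j m
  have s1 := H.shift (e := 0) hc hp2.le (by omega) (by omega)
  have s2 := H.shift (u := u⁻¹) (e := 0) hc.inv_left hp2.le (by rw [H.inv]; omega)
    (by rw [H.inv]; omega)
  rw [inv_inv] at s2
  have t1 := H.mul_le (u * p) ((u * p)⁻¹ * x)
  have t2 := H.mul_le (u⁻¹ * p) ((u⁻¹ * p)⁻¹ * x)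
  rw [mul_inv_cancel_left] at t1 t2
  have f := H.four_point p (u * p) 1 x
  have e1 : p⁻¹ * (u * p) = p⁻¹ * u * p := by group
  simp only [e1, inv_one, one_mul, mul_one, H.inv] at f
  have e2 : p⁻¹ * u ^ 2 * p = (u⁻¹ * p)⁻¹ * (u * p) := by simp [pow_two, mul_assoc]
  have g1 := H.le_mul_left (u⁻¹ * p)⁻¹ (u * p)
  have g2 := H.le_mul_right (u⁻¹ * p)⁻¹ (u * p)
  rw [H.inv, ← e2] at g1 g2
  omega

theorem isQuasiAdditive (H : IsHyperbolicLength ℓ δ) {z : Γ}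
    (hz : Function.Injective fun n : ℕ => z ^ n) : IsQuasiAdditive ℓ z := by
  obtain ⟨J, hJ, p, hp⟩ := H.exists_conj_pow_sq hz
  exact H.quasiAdditive_of_pow hJ (H.quasiAdditive_of_conj (H.quasiAdditive_of_sq hp))

/-! ### Neighbourhoods of powers and divergence of rays -/

/-- Discrete intermediate value theorem. -/
theorem exists_near_value {f : ℕ → ℕ} {s : ℕ} (hf : ∀ n, f (n + 1) ≤ f n + s) {b t : ℕ}
    (hb : t ≤ f b) : ∃ l ≤ b, t ≤ f l ∧ f l ≤ t + s + f 0 := by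
  classical
  have hex : ∃ l, t ≤ f l := ⟨b, hb⟩
  refine ⟨Nat.find hex, Nat.find_min' hex hb, Nat.find_spec hex, ?_⟩
  rcases h : Nat.find hex with - | l
  · omega
  · have h1 := Nat.find_min hex (m := l) (by omega)
    have h2 := hf l
    omega

/-- The centralizer of an element of infinite order lies in a neighbourhood of its powers. -/
theorem exists_bound_of_commute (H : IsHyperbolicLength ℓ δ) {z : Γ}
    (hz : Function.Injective fun n : ℕ => z ^ n) :
    ∃ R : ℕ, ∀ u, Commute u z → ∃ i : ℤ, ℓ (z ^ i * u) ≤ R := by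
  obtain ⟨D, hD⟩ := H.isQuasiAdditive hz
  refine ⟨ℓ z + D + 4 * δ, fun u hu => ?_⟩
  obtain ⟨l, hl⟩ := (H.eventually_lt hz (2 * ℓ u + D + δ)).exists
  have hc : Commute u (z ^ (l + l)) := hu.pow_right _
  have hM := hD l l
  have e1 : (z ^ l)⁻¹ * z ^ (l + l) = z ^ l := by rw [pow_add]; group
  have hs := H.shift (e := D) (p := z ^ l) hc (by rw [e1]; omega) (by omega) (by rw [e1]; omega)
  rw [e1] at hs
  have hy := H.mul_le u (z ^ l)
  -- By `shift`, `u * z ^ l` lies near the quasi-geodesic from `1` to `z ^ (l + l)`; a power `z ^ i`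
  -- about equally far from `1` must be close to it.
  obtain ⟨i, hi, hi1, hi2⟩ := exists_near_value (f := fun n => ℓ (z ^ n)) (s := ℓ z)
    (fun n => by rw [pow_succ]; exact H.mul_le _ _) (b := l + l) (t := ℓ (u * z ^ l)) (by
      omega)
  simp only [pow_zero, H.one, add_zero] at hi1 hi2
  obtain ⟨k, hk⟩ := Nat.exists_eq_add_of_le hi
  have hDi := hD i k
  rw [← hk] at hDi
  have f := H.four_point (z ^ i) (u * z ^ l) 1 (z ^ (l + l))
  have e2 : (z ^ i)⁻¹ * z ^ (l + l) = z ^ k := by rw [hk, pow_add]; group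
  simp only [e2, mul_one, one_mul, inv_one, H.inv] at f
  refine ⟨(l : ℤ) - i, ?_⟩
  have e3 : z ^ ((l : ℤ) - i) * u = (z ^ i)⁻¹ * (u * z ^ l) := by
    rw [(hu.pow_right l).eq, sub_eq_neg_add, zpow_add, zpow_neg, zpow_natCast, zpow_natCast,
      mul_assoc]
  rw [e3]
  omega

/-- If no non-trivial power of `z₁` is conjugate by `u` to a power of `z₂`, then the rays
`z₁ ^ a` and `u * z₂ ^ b` diverge. -/
theorem exists_bound_of_not_commensurable (H : IsHyperbolicLength ℓ δ) {z₁ z₂ u : Γ}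
    (h₁ : IsQuasiAdditive ℓ z₁) (h₂ : IsQuasiAdditive ℓ z₂)
    (hu : ∀ p q : ℤ, p ≠ 0 → u * z₂ ^ q * u⁻¹ ≠ z₁ ^ p) :
    ∃ K : ℕ, ∀ a b : ℕ, ℓ (z₁ ^ a) + ℓ (z₂ ^ b) ≤ ℓ ((z₁ ^ a)⁻¹ * u * z₂ ^ b) + K := by
  obtain ⟨D₁, hD₁⟩ := h₁
  obtain ⟨D₂, hD₂⟩ := h₂
  obtain ⟨N, hN⟩ := H.exists_lt_of_injective (ℓ z₂ + 3 * ℓ u + D₁ + D₂ + 2 * δ)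
  refine ⟨2 * (N * ℓ z₁) + ℓ u, fun a b => ?_⟩
  by_contra! hcon
  have hux := H.le_mul_left u (z₂ ^ b)
  have hy := H.mul_le u (z₂ ^ b)
  have hxy1 := H.le_mul_left (z₁ ^ a)⁻¹ (u * z₂ ^ b)
  have hxy2 := H.le_mul_right (z₁ ^ a)⁻¹ (u * z₂ ^ b)
  rw [H.inv, ← mul_assoc] at hxy1 hxy2
  have haN : N < a := by
    by_contra! h
    have := (H.pow_le z₁ a).trans (Nat.mul_le_mul_right (ℓ z₁) h)
    omega
  -- If the bound fails at `a`, `b`, the two rays fellow-travel at the start: every `z₁ ^ i` with `i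
  -- ≤ N` is uniformly close to some `u * z₂ ^ l`.
  have hex : ∀ i : ℕ, ∃ l : ℕ, i ≤ N →
      ℓ ((z₁ ^ i)⁻¹ * (u * z₂ ^ l)) ≤ ℓ z₂ + 3 * ℓ u + D₁ + D₂ + 2 * δ := fun i => by
    by_cases hi : i ≤ N
    swap
    · exact ⟨0, fun h => absurd h hi⟩
    have hi' := (H.pow_le z₁ i).trans (Nat.mul_le_mul_right (ℓ z₁) hi)
    obtain ⟨l, hl, hl1, hl2⟩ := exists_near_value (f := fun n => ℓ (u * z₂ ^ n)) (s := ℓ z₂)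
      (fun n => by rw [pow_succ, ← mul_assoc]; exact H.mul_le _ _) (b := b) (t := ℓ (z₁ ^ i)) (by
        omega)
    simp only [pow_zero, mul_one] at hl1 hl2
    refine ⟨l, fun _ => ?_⟩
    obtain ⟨k, hk⟩ := Nat.exists_eq_add_of_le (hi.trans haN.le)
    obtain ⟨c, hc⟩ := Nat.exists_eq_add_of_le hl
    have d1 := hD₁ i k
    have d2 := hD₂ l c
    rw [← hk] at d1
    rw [← hc] at d2
    have e1 : (z₁ ^ i)⁻¹ * z₁ ^ a = z₁ ^ k := by rw [hk, pow_add]; group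
    have e2 : (u * z₂ ^ l)⁻¹ * (u * z₂ ^ b) = z₂ ^ c := by rw [hc, pow_add]; group
    have f1 := H.four_point (z₁ ^ i) (u * z₂ ^ b) 1 (z₁ ^ a)
    have f2 := H.four_point (z₁ ^ i) (u * z₂ ^ l) 1 (u * z₂ ^ b)
    have e3 : (u * z₂ ^ b)⁻¹ * z₁ ^ a = ((z₁ ^ a)⁻¹ * u * z₂ ^ b)⁻¹ := by group
    simp only [e1, e2, e3, one_mul, mul_one, inv_one, H.inv] at f1 f2
    have g1 := H.mul_le u (z₂ ^ l)
    omega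
  choose l hl using hex
  -- Equal differences at `i ≠ i'` would conjugate a power of `z₂` to `z₁ ^ (i' - i)` by `u`. So the
  -- differences are distinct, and one of them is too long.
  obtain ⟨j, hjN, hj⟩ := hN (fun i => (z₁ ^ i)⁻¹ * (u * z₂ ^ l i)) fun i _ i' _ hii' => by
    by_contra hne
    simp only at hii'
    refine hu ((i' : ℤ) - i) ((l i' : ℤ) - l i) (by omega) ?_
    have : u * z₂ ^ l i' = z₁ ^ i' * ((z₁ ^ i)⁻¹ * (u * z₂ ^ l i)) := by rw [hii']; group
    rw [zpow_sub, zpow_sub, zpow_natCast, zpow_natCast, zpow_natCast, zpow_natCast,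
      ← mul_assoc u, this]
    group
  exact absurd (hl j hjN) (by simpa using hj)

end IsHyperbolicLength

/-! ### Centralizers in torsion-free hyperbolic groups -/

section TorsionFree

variable {Γ : Type*} [Group Γ]

theorem IsTorsionFreeGroup.zpow_injective (tf : IsTorsionFreeGroup Γ) {z : Γ} (hz : z ≠ 1) :
    Function.Injective fun n : ℤ => z ^ n :=
  injective_zpow_iff_not_isOfFinOrder.2 (tf z hz)

theorem IsTorsionFreeGroup.pow_injective (tf : IsTorsionFreeGroup Γ) {z : Γ} (hz : z ≠ 1) :
    Function.Injective fun n : ℕ => z ^ n :=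
  injective_pow_iff_not_isOfFinOrder.2 (tf z hz)

theorem IsTorsionFreeGroup.eq_zero_of_zpow_eq_one (tf : IsTorsionFreeGroup Γ) {z : Γ} (hz : z ≠ 1)
    {n : ℤ} (h : z ^ n = 1) : n = 0 :=
  tf.zpow_injective hz (by simpa using h)

namespace IsHyperbolicLength

variable {ℓ : Γ → ℕ} {δ : ℕ}

/-- By `exists_bound_of_commute`, every coset of the powers of `z` meets one finite ball. -/
theorem finiteIndex_zpowers (H : IsHyperbolicLength ℓ δ) (tf : IsTorsionFreeGroup Γ) {z : Γ}
    (hz : z ≠ 1) (T : Subgroup Γ) (hT : ∀ u ∈ T, Commute u z) (hzT : z ∈ T) :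
    ((Subgroup.zpowers z).subgroupOf T).FiniteIndex := by
  obtain ⟨R, hR⟩ := H.exists_bound_of_commute (tf.pow_injective hz)
  have hfin : Finite {b : T // ℓ b ≤ R} :=
    ((H.finite_ball R).preimage (Subtype.val_injective (p := (· ∈ T))).injOn).to_subtype
  have : Finite (T ⧸ (Subgroup.zpowers z).subgroupOf T) := by
    refine Finite.of_surjective (fun b : {b : T // ℓ b ≤ R} => (b.1 : T ⧸ _)) fun q => ?_
    induction q using QuotientGroup.induction_on with
    | H u =>
      obtain ⟨i, hi⟩ := hR u (hT u u.2)
      refine ⟨⟨⟨z, hzT⟩ ^ i * u, hi⟩, QuotientGroup.eq.2 ?_⟩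
      rw [Subgroup.mem_subgroupOf]
      refine ⟨-i, ?_⟩
      have := ((hT u u.2).zpow_right (-i)).eq
      simp [mul_assoc, ← zpow_neg, ← this]
  exact Subgroup.finiteIndex_of_finite_quotient

theorem not_central (H : IsHyperbolicLength ℓ δ) (tf : IsTorsionFreeGroup Γ)
    (nonelem : ¬ IsElementaryGroup Γ) {z : Γ} (hz : z ≠ 1) : ∃ u, ¬ Commute u z := by
  by_contra! hcon
  have h := H.finiteIndex_zpowers tf hz ⊤ (fun u _ => hcon u) trivial
  refine nonelem ⟨Subgroup.zpowers z, inferInstance, ⟨fun h0 => h.index_ne_zero ?_⟩⟩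
  rw [← Subgroup.relIndex_top_right] at h0
  exact h0

/-- Centralizers of non-trivial elements are abelian. -/
theorem commute_trans (H : IsHyperbolicLength ℓ δ) (tf : IsTorsionFreeGroup Γ) {z : Γ}
    (hz : z ≠ 1) {a b : Γ} (ha : Commute a z) (hb : Commute b z) : Commute a b := by
  let T := Subgroup.centralizer {z}
  have hT : ∀ u, u ∈ T ↔ Commute u z := fun u => by
    rw [Subgroup.mem_centralizer_singleton_iff]; exact Iff.rfl
  have hfin := H.finiteIndex_zpowers tf hz T (fun u hu => (hT u).1 hu) ((hT z).2 (Commute.refl z))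
  have hle : (Subgroup.zpowers z).subgroupOf T ≤ Subgroup.center T := by
    rintro ⟨_, hx⟩ ⟨n, rfl⟩
    rw [Subgroup.mem_center_iff]
    intro g
    exact Subtype.ext (((hT g).1 g.2).zpow_right n).eq
  have hcen : (Subgroup.center T).FiniteIndex := Subgroup.finiteIndex_of_le hle
  let x : T := ⟨a, (hT a).2 ha⟩
  let y : T := ⟨b, (hT b).2 hb⟩
  -- The transfer to the centre is raising to the power of its index. As a homomorphism to an
  -- abelian group it kills commutators, which are therefore torsion.
  have key : (x * y * x⁻¹ * y⁻¹) ^ (Subgroup.center T).index = 1 := by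
    rw [← MonoidHom.transferCenterPow_apply]
    have hc : MonoidHom.transferCenterPow T x * MonoidHom.transferCenterPow T y =
        MonoidHom.transferCenterPow T y * MonoidHom.transferCenterPow T x :=
      Subtype.ext (Subgroup.mem_center_iff.1 (MonoidHom.transferCenterPow T y).2 _)
    rw [map_mul, map_mul, map_mul, hc, map_inv, map_inv]
    simp
  have key2 : (a * b * a⁻¹ * b⁻¹) ^ (Subgroup.center T).index = 1 :=
    congrArg Subtype.val key
  by_contra hab
  have hne : a * b * a⁻¹ * b⁻¹ ≠ 1 := fun h => hab (by
    rw [mul_inv_eq_one, mul_inv_eq_iff_eq_mul] at h; exact h)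
  exact tf _ hne (isOfFinOrder_iff_pow_eq_one.2 ⟨_, Nat.pos_of_ne_zero hcen.index_ne_zero, key2⟩)

/-- An element that commutes with a proper power of `z` commutes with `z`. -/
theorem commute_of_commute_zpow (H : IsHyperbolicLength ℓ δ) (tf : IsTorsionFreeGroup Γ) {u z : Γ}
    {n : ℤ} (hn : n ≠ 0) (h : Commute u (z ^ n)) : Commute u z := by
  by_cases hz : z = 1
  · rw [hz]; exact Commute.one_right u
  · exact H.commute_trans tf (fun h0 => hn (tf.eq_zero_of_zpow_eq_one hz h0)) h
      (Commute.self_zpow z n)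

/-- Elements of a centralizer are commensurable. -/
theorem exists_pow_eq_zpow (H : IsHyperbolicLength ℓ δ) (tf : IsTorsionFreeGroup Γ) {u z : Γ}
    (hz : z ≠ 1) (h : Commute u z) : ∃ k : ℕ, 0 < k ∧ ∃ m : ℤ, u ^ k = z ^ m := by
  obtain ⟨R, hR⟩ := H.exists_bound_of_commute (tf.pow_injective hz)
  choose i hi using fun n : ℕ => hR (u ^ n) (h.pow_left n)
  obtain ⟨N, hN⟩ := H.exists_lt_of_injective R
  -- All `z ^ i n * u ^ n` lie in one ball, so two of them coincide.
  have hni : ¬ Set.InjOn (fun n => z ^ i n * u ^ n) (Set.Iic N) := fun hinj => by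
    obtain ⟨j, -, hj⟩ := hN _ hinj
    exact absurd (hi j) (by omega)
  have aux : ∀ a b : ℕ, a < b → z ^ i a * u ^ a = z ^ i b * u ^ b →
      ∃ k : ℕ, 0 < k ∧ ∃ m : ℤ, u ^ k = z ^ m := fun a b hab heq => by
    obtain ⟨k, rfl⟩ := Nat.exists_eq_add_of_lt hab
    refine ⟨k + 1, by omega, i a - i (a + k + 1), ?_⟩
    rw [show a + k + 1 = (k + 1) + a by ring] at heq ⊢
    rw [pow_add u, ← mul_assoc, mul_right_cancel_iff] at heq
    rw [sub_eq_neg_add, zpow_add, heq, zpow_neg, inv_mul_cancel_left]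
  simp only [Set.InjOn, not_forall] at hni
  obtain ⟨a, -, b, -, heq, hne⟩ := hni
  rcases lt_or_gt_of_ne hne with hab | hab
  exacts [aux a b hab heq, aux b a hab heq.symm]

theorem length_zpow (H : IsHyperbolicLength ℓ δ) (z : Γ) (n : ℤ) :
    ℓ (z ^ n) = ℓ (z ^ n.natAbs) := by
  rcases Int.natAbs_eq n with h | h
  · conv_lhs => rw [h, zpow_natCast]
  · conv_lhs => rw [h, zpow_neg, zpow_natCast, H.inv]

/-- Conjugation by `u` changes lengths by at most `2 * ℓ u`, whereas for `|p| > |q|` the lengths of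
`z ^ (p * k)` and `z ^ (q * k)` would drift apart without bound as `k` grows. -/
theorem natAbs_le_of_conj (H : IsHyperbolicLength ℓ δ) (tf : IsTorsionFreeGroup Γ) {u z : Γ}
    (hz : z ≠ 1) {p q : ℤ} (h : u * z ^ q * u⁻¹ = z ^ p) : p.natAbs ≤ q.natAbs := by
  by_contra! hd
  obtain ⟨d, hd⟩ := Nat.exists_eq_add_of_lt hd
  obtain ⟨D, hD⟩ := H.isQuasiAdditive (tf.pow_injective hz)
  obtain ⟨k, hk⟩ := (H.eventually_lt (f := fun k : ℕ => z ^ ((d + 1) * k))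
    (fun a b hab => Nat.eq_of_mul_eq_mul_left d.succ_pos (tf.pow_injective hz hab))
    (D + 2 * ℓ u)).exists
  have e : u * z ^ (q * k) * u⁻¹ = z ^ (p * k) := by
    rw [zpow_mul, zpow_mul, ← h, conj_zpow]
  have h1 := H.mul_le (u * z ^ (q * k)) u⁻¹
  have h2 := H.mul_le u (z ^ (q * k))
  rw [e, H.inv, H.length_zpow z (p * k), Int.natAbs_mul, Int.natAbs_natCast, hd, add_assoc,
    add_mul] at h1
  rw [H.length_zpow z (q * k), Int.natAbs_mul, Int.natAbs_natCast] at h2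
  have := hD (q.natAbs * k) ((d + 1) * k)
  omega

/-- If `u` conjugates a power of `z` to a non-trivial power of `z`, then `u` commutes with `z`. -/
theorem commute_of_conj_zpow (H : IsHyperbolicLength ℓ δ) (tf : IsTorsionFreeGroup Γ) {u z : Γ}
    (hz : z ≠ 1) {p q : ℤ} (hp : p ≠ 0) (h : u * z ^ q * u⁻¹ = z ^ p) : Commute u z := by
  have h' : u⁻¹ * z ^ p * u⁻¹⁻¹ = z ^ q := by rw [← h]; group
  have hpq := le_antisymm (H.natAbs_le_of_conj tf hz h) (H.natAbs_le_of_conj tf hz h')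
  rcases Int.natAbs_eq_natAbs_iff.1 hpq with rfl | rfl
  · exact H.commute_of_commute_zpow tf hp (mul_inv_eq_iff_eq_mul.1 h)
  have hq : q ≠ 0 := by omega
  -- Here `u` inverts `z ^ q`, so `u ^ 2` commutes with `z` and has a positive power equal to some
  -- `z ^ m`. Then `u` both inverts and centralizes `z ^ (q * m)`, whence `m = 0` and `u` is
  -- torsion, so trivial.
  have hu2 : Commute (u ^ 2) z := by
    refine H.commute_of_commute_zpow tf hq (mul_inv_eq_iff_eq_mul.1 ?_)
    calc u ^ 2 * z ^ q * (u ^ 2)⁻¹ = u * (u * z ^ q * u⁻¹) * u⁻¹ := by simp [pow_two, mul_assoc]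
      _ = (u * z ^ q * u⁻¹)⁻¹ := by
        conv_lhs => rw [h, zpow_neg]
        simp [mul_assoc]
      _ = z ^ q := by rw [h, zpow_neg, inv_inv]
  obtain ⟨k, hk, m, hm⟩ := H.exists_pow_eq_zpow tf hz hu2
  have h1 : u * z ^ (q * m) * u⁻¹ = z ^ (-(q * m)) := by
    rw [zpow_mul, ← conj_zpow, h, ← zpow_mul, neg_mul]
  have h2 : Commute u (z ^ (q * m)) := by
    rw [mul_comm, zpow_mul, ← hm, ← pow_mul]
    exact ((Commute.refl u).pow_right _).zpow_right _
  rw [h2.eq, mul_inv_cancel_right] at h1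
  have h3 : q * m = -(q * m) := tf.zpow_injective hz h1
  have hm0 : m = 0 := by
    have : q * m = 0 := by omega
    exact (mul_eq_zero.1 this).resolve_left hq
  rw [hm0, zpow_zero, ← pow_mul] at hm
  by_cases hu1 : u = 1
  · rw [hu1]; exact Commute.one_left z
  · exact absurd (isOfFinOrder_iff_pow_eq_one.2 ⟨_, by omega, hm⟩) (tf u hu1)

/-- The four sign patterns of `j`, `k` are four pairs of rays along `z` and `z⁻¹`; each pair
diverges because `commute_of_conj_zpow` excludes commensurability through `u`. -/
theorem exists_bound_of_not_commute (H : IsHyperbolicLength ℓ δ) (tf : IsTorsionFreeGroup Γ)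
    {u z : Γ} (h : ¬ Commute u z) :
    ∃ K : ℕ, ∀ j k : ℤ, ℓ (z ^ j) + ℓ (z ^ k) ≤ ℓ (z ^ j * u * z ^ k) + K := by
  have hz : z ≠ 1 := fun h0 => h (h0 ▸ Commute.one_right u)
  have q1 := H.isQuasiAdditive (tf.pow_injective hz)
  have q2 := H.isQuasiAdditive (tf.pow_injective (inv_ne_one.2 hz))
  have key : ∀ p q : ℤ, p ≠ 0 → u * z ^ q * u⁻¹ ≠ z ^ p := fun p q hp hpq =>
    h (H.commute_of_conj_zpow tf hz hp hpq)
  obtain ⟨K₁, h₁⟩ := H.exists_bound_of_not_commensurable q1 q1 key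
  obtain ⟨K₂, h₂⟩ := H.exists_bound_of_not_commensurable (u := u) q1 q2 fun p q hp => by
    rw [inv_zpow']; exact key p (-q) hp
  obtain ⟨K₃, h₃⟩ := H.exists_bound_of_not_commensurable (u := u) q2 q1 fun p q hp => by
    rw [inv_zpow']; exact key (-p) q (neg_ne_zero.2 hp)
  obtain ⟨K₄, h₄⟩ := H.exists_bound_of_not_commensurable (u := u) q2 q2 fun p q hp => by
    rw [inv_zpow', inv_zpow']; exact key (-p) (-q) (neg_ne_zero.2 hp)
  refine ⟨K₁ + K₂ + K₃ + K₄, fun j k => ?_⟩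
  obtain ⟨a, rfl | rfl⟩ := Int.eq_nat_or_neg j <;> obtain ⟨b, rfl | rfl⟩ := Int.eq_nat_or_neg k
  · have := h₃ a b
    simp only [inv_pow, inv_inv, H.inv, zpow_natCast] at this ⊢
    omega
  · have := h₄ a b
    simp only [inv_pow, inv_inv, H.inv, zpow_neg, zpow_natCast] at this ⊢
    omega
  · have := h₁ a b
    simp only [H.inv, zpow_neg, zpow_natCast] at this ⊢
    omega
  · have := h₂ a b
    simp only [inv_pow, H.inv, zpow_neg, zpow_natCast] at this ⊢
    omega

end IsHyperbolicLength

end TorsionFree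

/-! ### Big powers -/

section PowerFunctions

variable {Γ : Type*} [Group Γ]

/-- The group of functions `ℕ → Γ` generated by the constants and by `n ↦ z ^ n`. -/
def powerFunctions (z : Γ) : Subgroup (ℕ → Γ) :=
  Subgroup.closure (Set.range (Function.const ℕ) ∪ {fun n => z ^ n})

/-- The product of the `z ^ (m * n) * u` over the entries `(m, u)` of a list. -/
def powerWord (z : Γ) (L : List (ℤ × Γ)) (n : ℕ) : Γ :=
  (L.map fun a => z ^ (a.1 * (n : ℤ)) * a.2).prod

/-- No exponent vanishes and no coefficient between two powers of `z` commutes with `z`. -/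
def IsReducedPowerWord (z : Γ) (L : List (ℤ × Γ)) : Prop :=
  (∀ a ∈ L, a.1 ≠ 0) ∧ L.IsChain fun a _ => ¬ Commute a.2 z

theorem powerWord_cons (z : Γ) (a : ℤ × Γ) (L : List (ℤ × Γ)) (n : ℕ) :
    powerWord z (a :: L) n = z ^ (a.1 * n) * a.2 * powerWord z L n := by
  simp [powerWord]

/-- If `u` does not commute with `z`, or the word is empty, the new power starts a new syllable.
Otherwise it slides past `u` and merges with the first syllable; if the exponents cancel, that
syllable disappears and its coefficient joins the constant on the left. -/
theorem exists_reduced_zpow_mul (z u : Γ) (L : List (ℤ × Γ)) (hL : IsReducedPowerWord z L)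
    {e : ℤ} (he : e ≠ 0) :
    ∃ u' L', IsReducedPowerWord z L' ∧
      ∀ n : ℕ, z ^ (e * n) * (u * powerWord z L n) = u' * powerWord z L' n := by
  obtain ⟨h1, h2⟩ := hL
  rcases L with - | ⟨⟨m, v⟩, L⟩
  · exact ⟨1, [(e, u)], ⟨by simpa using he, by simp⟩, fun n => by simp [powerWord]⟩
  by_cases hu : Commute u z
  swap
  · refine ⟨1, (e, u) :: (m, v) :: L, ⟨?_, ?_⟩, fun n => ?_⟩
    · intro a ha
      rcases List.mem_cons.1 ha with rfl | ha
      exacts [he, h1 a ha]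
    · exact List.isChain_cons_cons.2 ⟨hu, h2⟩
    · rw [powerWord_cons z (e, u), one_mul, mul_assoc]
  have hcomm : ∀ n : ℕ, z ^ (e * n) * (u * powerWord z ((m, v) :: L) n) =
      u * (z ^ ((e + m) * n) * v * powerWord z L n) := fun n => by
    rw [powerWord_cons, ← mul_assoc, ← ((hu.zpow_right (e * n)).eq), add_mul, zpow_add]
    simp only [mul_assoc]
  by_cases hem : e + m = 0
  · refine ⟨u * v, L, ⟨fun a ha => h1 a (List.mem_cons_of_mem _ ha), h2.tail⟩, fun n => ?_⟩
    rw [hcomm, hem]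
    simp [mul_assoc]
  · refine ⟨u, (e + m, v) :: L, ⟨?_, ?_⟩, fun n => by rw [hcomm, powerWord_cons]⟩
    · intro a ha
      rcases List.mem_cons.1 ha with rfl | ha
      exacts [hem, h1 a (List.mem_cons_of_mem _ ha)]
    · rcases L with - | ⟨b, L⟩
      · simp
      · rw [List.isChain_cons_cons] at h2 ⊢
        exact h2

theorem exists_reduced_of_mem_powerFunctions {z : Γ} {w : ℕ → Γ} (hw : w ∈ powerFunctions z) :
    ∃ u L, IsReducedPowerWord z L ∧ ∀ n, w n = u * powerWord z L n := by
  refine Subgroup.closure_induction_left (p := fun w _ => ∃ u L, IsReducedPowerWord z L ∧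
    ∀ n, w n = u * powerWord z L n) ?_ ?_ ?_ hw
  · exact ⟨1, [], ⟨by simp, by simp⟩, fun n => by simp [powerWord]⟩
  · rintro x (⟨g, rfl⟩ | rfl) y - ⟨u, L, hL, hy⟩
    · exact ⟨g * u, L, hL, fun n => by simp [hy, mul_assoc]⟩
    · obtain ⟨u', L', hL', h⟩ := exists_reduced_zpow_mul z u L hL (e := 1) one_ne_zero
      exact ⟨u', L', hL', fun n => by rw [← h, Pi.mul_apply, hy]; simp⟩
  · rintro x (⟨g, rfl⟩ | rfl) y - ⟨u, L, hL, hy⟩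
    · exact ⟨g⁻¹ * u, L, hL, fun n => by simp [hy, mul_assoc]⟩
    · obtain ⟨u', L', hL', h⟩ := exists_reduced_zpow_mul z u L hL (e := -1) (by norm_num)
      exact ⟨u', L', hL', fun n => by rw [← h, Pi.mul_apply, hy]; simp⟩

namespace IsHyperbolicLength

variable {ℓ : Γ → ℕ} {δ : ℕ}

theorem eventually_lt_zpow (H : IsHyperbolicLength ℓ δ) (tf : IsTorsionFreeGroup Γ) {z : Γ}
    (hz : z ≠ 1) {m : ℤ} (hm : m ≠ 0) (B : ℕ) :
    ∀ᶠ n : ℕ in Filter.atTop, B < ℓ (z ^ (m * n)) :=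
  H.eventually_lt (fun a b hab => by
    have := mul_left_cancel₀ hm (tf.zpow_injective hz hab)
    exact_mod_cast this) B

/-- Big powers: the factors of a reduced word in large powers of `z` do not cancel. -/
theorem eventually_le_powerWord (H : IsHyperbolicLength ℓ δ) (tf : IsTorsionFreeGroup Γ) {z : Γ}
    (hz : z ≠ 1) (L : List (ℤ × Γ)) :
    ∀ m u, IsReducedPowerWord z ((m, u) :: L) → ∃ c : ℕ, ∀ᶠ n : ℕ in Filter.atTop,
      ℓ (z ^ (m * n)) + ℓ (powerWord z L n) ≤ ℓ (powerWord z ((m, u) :: L) n) + c := by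
  induction L with
  | nil =>
    intro m u _
    refine ⟨ℓ u, Filter.Eventually.of_forall fun n => ?_⟩
    rw [powerWord_cons]
    simpa [powerWord, H.one] using H.le_mul_right (z ^ (m * n)) u
  | cons b L ih =>
    obtain ⟨m', u'⟩ := b
    rintro m u ⟨h1, h2⟩
    rw [List.isChain_cons_cons] at h2
    obtain ⟨c', hc'⟩ := ih m' u' ⟨fun a ha => h1 a (List.mem_cons_of_mem _ ha), h2.2⟩
    obtain ⟨K, hK⟩ := H.exists_bound_of_not_commute tf h2.1
    refine ⟨K + 2 * ℓ u' + 2 * ℓ u + δ, ?_⟩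
    filter_upwards [hc', H.eventually_lt_zpow tf hz (h1 (m', u') (by simp))
      (c' + K + 4 * ℓ u' + 2 * ℓ u + δ)] with n hn1 hn2
    have e1 := powerWord_cons z (m, u) ((m', u') :: L) n
    have e2 := powerWord_cons z (m', u') L n
    have hQ := hK (m * n) (m' * n)
    simp only at e1 e2 hQ
    set A := z ^ (m * (n : ℤ))
    set B := z ^ (m' * (n : ℤ))
    set v := powerWord z ((m, u) :: (m', u') :: L) n
    set v' := powerWord z ((m', u') :: L) n
    set v'' := powerWord z L n
    -- The alternative not involving `ℓ v` would bound `2 * ℓ B` by a constant, since `B` cancels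
    -- little on either side; `hn2` excludes it.
    have f := H.four_point 1 (A * u * (B * u')) (A * u) v
    have g1 : (A * u)⁻¹ * v = v' := by rw [e1]; group
    have g2 : (A * u * (B * u'))⁻¹ * v = v'' := by rw [e1, e2]; group
    have g3 : (A * u * (B * u'))⁻¹ * (A * u) = (B * u')⁻¹ := by group
    simp only [g1, g2, g3, inv_one, one_mul, H.inv] at f
    have k1 := H.mul_le A u
    have k2 := H.le_mul_right A u
    have k3 := H.mul_le B u'
    have k4 := H.le_mul_right B u'
    have k5 := H.le_mul_right (A * u * B) u'
    rw [mul_assoc (A * u)] at k5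
    omega

/-- A reduced form without syllables is a constant, determined by its value at `0`; any other has
length tending to infinity. -/
theorem eventually_ne_one (H : IsHyperbolicLength ℓ δ) (tf : IsTorsionFreeGroup Γ) {z : Γ}
    (hz : z ≠ 1) {w : ℕ → Γ} (hw : w ∈ powerFunctions z) (h0 : w 0 ≠ 1) :
    ∀ᶠ n in Filter.atTop, w n ≠ 1 := by
  obtain ⟨u, L, hL, h⟩ := exists_reduced_of_mem_powerFunctions hw
  rcases L with - | ⟨⟨m, v⟩, L⟩
  · refine Filter.Eventually.of_forall fun n => ?_
    rw [h] at h0 ⊢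
    simpa [powerWord] using h0
  · obtain ⟨c, hc⟩ := H.eventually_le_powerWord tf hz L m v hL
    filter_upwards [hc, H.eventually_lt_zpow tf hz (hL.1 (m, v) (by simp)) (c + ℓ u)] with n h1 h2
    intro h3
    rw [h] at h3
    have := H.le_mul_left u (powerWord z ((m, v) :: L) n)
    rw [h3, H.one] at this
    omega

end IsHyperbolicLength

end PowerFunctions

/-! ### Universal properties of splittings -/

section Extension

variable {G K : Type*} [Group G] [Group K]

/-- The isomorphism of the amalgamated product of the vertex groups with `G`. -/
noncomputable def AmalgamSplitting.equiv (S : AmalgamSplitting G) :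
    Monoid.PushoutI (fun i => Subgroup.inclusion (S.edge_le i)) ≃* G :=
  MulEquiv.ofBijective _ S.bijective

/-- The inclusion of a vertex group into the amalgamated product. -/
def AmalgamSplitting.of (S : AmalgamSplitting G) (j : Bool) :
    S.vertex j →* Monoid.PushoutI (fun i => Subgroup.inclusion (S.edge_le i)) :=
  Monoid.PushoutI.of (φ := fun i => Subgroup.inclusion (S.edge_le i)) j

theorem AmalgamSplitting.equiv_of (S : AmalgamSplitting G) (j : Bool) (v : S.vertex j) :
    S.equiv (S.of j v) = v := by
  unfold AmalgamSplitting.equiv AmalgamSplitting.of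
  rw [MulEquiv.ofBijective_apply]
  exact Monoid.PushoutI.lift_of (φ := fun i => Subgroup.inclusion (S.edge_le i))
    (fun i => (S.vertex i).subtype) S.edge.subtype (fun _ => rfl) v

theorem AmalgamSplitting.equiv_symm_coe (S : AmalgamSplitting G) (j : Bool) (v : S.vertex j) :
    S.equiv.symm (v : G) = S.of j v := by
  rw [← S.equiv_of, MulEquiv.symm_apply_apply]

theorem AmalgamSplitting.exists_extension_forall (S : AmalgamSplitting G)
    (φ : ∀ j, S.vertex j →* K)
    (hφ : ∀ c (hc : c ∈ S.edge),
      φ false ⟨c, S.edge_le false hc⟩ = φ true ⟨c, S.edge_le true hc⟩) :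
    ∃ F : G →* K, ∀ j, ∀ v : S.vertex j, F v = φ j v := by
  have hk : ∀ j, (φ j).comp (Subgroup.inclusion (S.edge_le j)) =
      (φ true).comp (Subgroup.inclusion (S.edge_le true)) := fun j => by
    ext c
    cases j
    exacts [hφ c c.2, rfl]
  refine ⟨(Monoid.PushoutI.lift (φ := fun i => Subgroup.inclusion (S.edge_le i)) φ _ hk).comp
    S.equiv.symm.toMonoidHom, fun j v => ?_⟩
  rw [MonoidHom.comp_apply, MulEquiv.toMonoidHom_eq_coe, MonoidHom.coe_coe, S.equiv_symm_coe]
  exact Monoid.PushoutI.lift_of (φ := fun i => Subgroup.inclusion (S.edge_le i)) φ _ hk v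

theorem AmalgamSplitting.exists_extension (S : AmalgamSplitting G) (i : Bool)
    (α : S.vertex i →* K) (β : S.vertex (!i) →* K)
    (h : ∀ c (hc : c ∈ S.edge), α ⟨c, S.edge_le i hc⟩ = β ⟨c, S.edge_le (!i) hc⟩) :
    ∃ F : G →* K, (∀ v : S.vertex i, F v = α v) ∧ ∀ w : S.vertex (!i), F w = β w := by
  cases i
  · obtain ⟨F, hF⟩ := S.exists_extension_forall
      (fun j => match j with | false => α | true => β) h
    exact ⟨F, hF false, hF true⟩
  · obtain ⟨F, hF⟩ := S.exists_extension_forall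
      (fun j => match j with | false => β | true => α) fun c hc => (h c hc).symm
    exact ⟨F, hF true, hF false⟩

theorem AmalgamSplitting.hom_ext (S : AmalgamSplitting G) (i : Bool) {f g : G →* K}
    (h₁ : ∀ v ∈ S.vertex i, f v = g v) (h₂ : ∀ w ∈ S.vertex (!i), f w = g w) : f = g := by
  rw [← MonoidHom.cancel_right (f := S.equiv.toMonoidHom) S.equiv.surjective]
  refine Monoid.PushoutI.hom_ext_nonempty fun j => MonoidHom.ext fun v => ?_
  change f (S.equiv (S.of j v)) = g (S.equiv (S.of j v))
  rw [S.equiv_of]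
  rcases Bool.eq_or_eq_not j i with rfl | rfl
  exacts [h₁ v v.2, h₂ v v.2]

/-- The isomorphism of the HNN extension of the vertex group with `G`. -/
noncomputable def HNNSplitting.equiv (S : HNNSplitting G) :
    HNNExtension S.vertex S.edge S.edge' S.φ ≃* G :=
  MulEquiv.ofBijective _ S.bijective

theorem HNNSplitting.equiv_of (S : HNNSplitting G) (v : S.vertex) :
    S.equiv (HNNExtension.of v) = v := by
  unfold HNNSplitting.equiv
  rw [MulEquiv.ofBijective_apply, HNNExtension.lift_of]
  rfl

theorem HNNSplitting.equiv_t (S : HNNSplitting G) : S.equiv HNNExtension.t = S.t := by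
  unfold HNNSplitting.equiv
  rw [MulEquiv.ofBijective_apply, HNNExtension.lift_t]

theorem HNNSplitting.exists_extension (S : HNNSplitting G) (α : S.vertex →* K) (x : K)
    (h : ∀ c : S.edge, x * α c = α (S.φ c) * x) :
    ∃ F : G →* K, (∀ v : S.vertex, F v = α v) ∧ F S.t = x := by
  refine ⟨(HNNExtension.lift α x h).comp S.equiv.symm.toMonoidHom, fun v => ?_, ?_⟩
  · rw [MonoidHom.comp_apply, MulEquiv.toMonoidHom_eq_coe, MonoidHom.coe_coe, ← S.equiv_of,
      MulEquiv.symm_apply_apply, HNNExtension.lift_of]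
  · rw [MonoidHom.comp_apply, MulEquiv.toMonoidHom_eq_coe, MonoidHom.coe_coe, ← S.equiv_t,
      MulEquiv.symm_apply_apply, HNNExtension.lift_t]

theorem HNNSplitting.hom_ext (S : HNNSplitting G) {f g : G →* K}
    (h₁ : ∀ v ∈ S.vertex, f v = g v) (h₂ : f S.t = g S.t) : f = g := by
  rw [← MonoidHom.cancel_right (f := S.equiv.toMonoidHom) S.equiv.surjective]
  refine HNNExtension.hom_ext (MonoidHom.ext fun v => ?_) ?_
  · change f (S.equiv (HNNExtension.of v)) = g (S.equiv (HNNExtension.of v))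
    rw [S.equiv_of]
    exact h₁ v v.2
  · change f (S.equiv HNNExtension.t) = g (S.equiv HNNExtension.t)
    rw [S.equiv_t]
    exact h₂

end Extension

/-! ### Maps of abelian vertex groups to the integers -/

section IntegerQuotient

theorem exists_hom_int_ne_one (Q : Type*) [CommGroup Q] [Group.FG Q] [Infinite Q] :
    ∃ p : Q →* Multiplicative ℤ, ∃ x, p x ≠ 1 := by
  obtain ⟨ι, j, _, _, p, hp, e, ⟨f⟩⟩ := CommGroup.equiv_free_prod_prod_multiplicative_zmod Q
  rcases isEmpty_or_nonempty j with hj | ⟨⟨j₀⟩⟩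
  · have : ∀ i, Finite (Multiplicative (ZMod (p i ^ e i))) := fun i => by
      have : NeZero (p i ^ e i) := ⟨pow_ne_zero _ (hp i).ne_zero⟩
      exact inferInstanceAs (Finite (ZMod (p i ^ e i)))
    exact absurd (Finite.of_equiv _ f.symm.toEquiv) (not_finite_iff_infinite.2 ‹Infinite Q›)
  · refine ⟨((Pi.evalMonoidHom _ j₀).comp (MonoidHom.fst _ _)).comp f.toMonoidHom,
      f.symm (fun _ => Multiplicative.ofAdd 1, 1), ?_⟩
    simp only [MonoidHom.comp_apply, MulEquiv.toMonoidHom_eq_coe, MonoidHom.coe_coe,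
      MulEquiv.apply_symm_apply, MonoidHom.coe_fst, Pi.evalMonoidHom_apply]
    decide

/-- If the second vertex group is abelian and the edge group has infinite index in it, then it
maps non-trivially to `ℤ` with the edge group in the kernel. -/
theorem AmalgamSplitting.exists_hom_int {G : Type*} [Group G] [Group.FG G] (S : AmalgamSplitting G)
    (i : Bool) (hab : ∀ x ∈ S.vertex (!i), ∀ y ∈ S.vertex (!i), x * y = y * x)
    (hidx : S.edge.relIndex (S.vertex (!i)) = 0) :
    ∃ p : S.vertex (!i) →* Multiplicative ℤ,
      (∀ c (hc : c ∈ S.edge), p ⟨c, S.edge_le (!i) hc⟩ = 1) ∧ ∃ w, p w ≠ 1 := by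
  let W := S.vertex (!i)
  let N : Subgroup W := S.edge.subgroupOf W
  have hN : N.Normal := ⟨fun n hn g => by
    have : g * n * g⁻¹ = n := by
      rw [mul_inv_eq_iff_eq_mul]
      exact Subtype.ext (hab g g.2 n n.2)
    rwa [this]⟩
  let _ : CommGroup (W ⧸ N) :=
    { (inferInstance : Group (W ⧸ N)) with
      mul_comm := fun a b => by
        induction a using QuotientGroup.induction_on with
        | H a =>
          induction b using QuotientGroup.induction_on with
          | H b => exact congrArg (QuotientGroup.mk' N) (Subtype.ext (hab a a.2 b b.2)) }
  have hinf : Infinite (W ⧸ N) := by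
    by_contra hfin
    rw [not_infinite_iff_finite] at hfin
    exact (Subgroup.finiteIndex_of_finite_quotient (H := N)).index_ne_zero hidx
  -- Finite generation of `W ⧸ N` comes from `G`, which maps onto it by killing the other vertex
  -- group; finite generation of `W` is not needed.
  obtain ⟨F, -, hF⟩ := S.exists_extension i (1 : _ →* W ⧸ N) (QuotientGroup.mk' N)
    fun c hc => ((QuotientGroup.eq_one_iff _).2 (Subgroup.mem_subgroupOf.2 hc)).symm
  have hfg : Group.FG (W ⧸ N) := Group.fg_of_surjective (f := F) fun q => by
    obtain ⟨w, rfl⟩ := QuotientGroup.mk'_surjective N q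
    exact ⟨w, hF w⟩
  obtain ⟨p, x, hx⟩ := exists_hom_int_ne_one (W ⧸ N)
  obtain ⟨w, rfl⟩ := QuotientGroup.mk'_surjective N x
  refine ⟨p.comp (QuotientGroup.mk' N), fun c hc => ?_, w, hx⟩
  have : QuotientGroup.mk' N ⟨c, S.edge_le (!i) hc⟩ = 1 :=
    (QuotientGroup.eq_one_iff _).2 (Subgroup.mem_subgroupOf.2 hc)
  rw [MonoidHom.comp_apply, this, map_one]

end IntegerQuotient

/-! ### Twisting homomorphisms -/

section Twists

variable {Γ : Type*} [Group Γ]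

namespace powerFunctions

/-- Evaluation of a function in `powerFunctions z`. -/
def eval (z : Γ) (n : ℕ) : powerFunctions z →* Γ :=
  (Pi.evalMonoidHom (fun _ => Γ) n).comp (powerFunctions z).subtype

/-- The constant functions. -/
def const (z : Γ) : Γ →* powerFunctions z where
  toFun g := ⟨Function.const ℕ g, Subgroup.subset_closure (Or.inl ⟨g, rfl⟩)⟩
  map_one' := rfl
  map_mul' _ _ := rfl

/-- The function `n ↦ z ^ n`. -/
def gen (z : Γ) : powerFunctions z :=
  ⟨fun n => z ^ n, Subgroup.subset_closure (Or.inr rfl)⟩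

@[simp]
theorem eval_const (z : Γ) (n : ℕ) (g : Γ) : eval z n (const z g) = g := rfl

@[simp]
theorem eval_gen (z : Γ) (n : ℕ) : eval z n (gen z) = z ^ n := rfl

theorem commute_gen {z g : Γ} (h : Commute g z) : Commute (const z g) (gen z) :=
  Subtype.ext (funext fun n => (h.pow_right n).eq)

end powerFunctions

open powerFunctions

variable {G : Type*} [Group G]

/-- A sequence of pairwise distinct homomorphisms that agree with `h` on `V` and, eventually,
do not kill any given element outside the kernel of `h`. -/
structure IsTwistSequence (h : G →* Γ) (V : Subgroup G) (f : ℕ → G →* Γ) : Prop where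
  injective : Function.Injective f
  eqOn : ∀ n, ∀ v ∈ V, f n v = h v
  eventually_ne_one : ∀ g, h g ≠ 1 → ∀ᶠ n in Filter.atTop, f n g ≠ 1

variable {ℓ : Γ → ℕ} {δ : ℕ}

theorem IsHyperbolicLength.isTwistSequence (H : IsHyperbolicLength ℓ δ)
    (tf : IsTorsionFreeGroup Γ) {z : Γ} (hz : z ≠ 1) {h : G →* Γ} {V : Subgroup G}
    (F : G →* powerFunctions z) (h0 : (eval z 0).comp F = h)
    (hV : ∀ v ∈ V, F v = const z (h v))
    (hinj : ∃ w, Function.Injective fun n => eval z n (F w)) :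
    IsTwistSequence h V fun n => (eval z n).comp F where
  injective := fun n m hnm => by
    obtain ⟨w, hw⟩ := hinj
    exact hw (DFunLike.congr_fun hnm w)
  eqOn := fun n v hv => by rw [MonoidHom.comp_apply, hV v hv, eval_const]
  eventually_ne_one := fun g hg => by
    rw [← h0] at hg
    exact H.eventually_ne_one tf hz (F g).2 hg

/-- The twist sends `t` to `h t * z ^ n`; the HNN relation survives because `z` commutes with the
image of the edge group. -/
theorem IsHyperbolicLength.exists_twist_hnn (H : IsHyperbolicLength ℓ δ)
    (tf : IsTorsionFreeGroup Γ) (S : HNNSplitting G) (h : G →* Γ) {z : Γ} (hz : z ≠ 1)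
    (hc : ∀ c : S.edge, Commute (h c) z) : ∃ f, IsTwistSequence h S.vertex f := by
  obtain ⟨F, hF, hFt⟩ := S.exists_extension (((const z).comp h).comp S.vertex.subtype)
    (const z (h S.t) * gen z) fun c => by
      have h1 : S.t * (c : G) = (S.φ c : G) * S.t := S.conj c
      have h2 := commute_gen (hc c)
      simp only [MonoidHom.comp_apply, Subgroup.subtype_apply]
      rw [mul_assoc, ← h2.eq, ← mul_assoc, ← mul_assoc, ← map_mul, ← map_mul, ← map_mul,
        ← map_mul, h1]
  refine ⟨_, H.isTwistSequence tf hz F (S.hom_ext (fun v hv => ?_) ?_) (fun v hv => hF ⟨v, hv⟩)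
    ⟨S.t, fun n m hnm => tf.pow_injective hz ?_⟩⟩
  · rw [MonoidHom.comp_apply, hF ⟨v, hv⟩]; rfl
  · rw [MonoidHom.comp_apply, hFt]; simp
  · simpa [hFt] using hnm

/-- The other vertex group is conjugated by `z ^ n`. If two twists agreed at `w`, then `h w` would
commute with a non-trivial power of `z`, hence with `z`. -/
theorem IsHyperbolicLength.exists_twist_amalgam_conj (H : IsHyperbolicLength ℓ δ)
    (tf : IsTorsionFreeGroup Γ) (S : AmalgamSplitting G) (i : Bool) (h : G →* Γ) {z : Γ}
    (hc : ∀ c ∈ S.edge, Commute (h c) z) {w : G} (hw : w ∈ S.vertex (!i))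
    (hwz : ¬ Commute (h w) z) : ∃ f, IsTwistSequence h (S.vertex i) f := by
  have hz : z ≠ 1 := fun h0 => hwz (h0 ▸ Commute.one_right _)
  obtain ⟨F, hF, hF'⟩ := S.exists_extension i (((const z).comp h).comp (S.vertex i).subtype)
    ((((MulAut.conj (gen z)).toMonoidHom.comp (const z)).comp h).comp (S.vertex (!i)).subtype)
    fun c hcS => by
      have h2 := (commute_gen (hc c hcS)).eq
      simp only [MonoidHom.comp_apply, Subgroup.subtype_apply, MulEquiv.toMonoidHom_eq_coe,
        MonoidHom.coe_coe, MulAut.conj_apply]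
      rw [← h2, mul_inv_cancel_right]
  refine ⟨_, H.isTwistSequence tf hz F (S.hom_ext i (fun v hv => ?_) fun v hv => ?_)
    (fun v hv => hF ⟨v, hv⟩) ⟨w, fun n m hnm => ?_⟩⟩
  · rw [MonoidHom.comp_apply, hF ⟨v, hv⟩]; rfl
  · rw [MonoidHom.comp_apply, hF' ⟨v, hv⟩]; simp
  · by_contra hne
    simp only [hF' ⟨w, hw⟩, MonoidHom.comp_apply, Subgroup.subtype_apply,
      MulEquiv.toMonoidHom_eq_coe, MonoidHom.coe_coe, MulAut.conj_apply, map_mul, map_inv,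
      eval_const, eval_gen] at hnm
    refine hwz (H.commute_of_commute_zpow tf (n := (n : ℤ) - m) (by omega) ?_)
    rw [sub_eq_neg_add, zpow_add, zpow_neg, zpow_natCast, zpow_natCast]
    have h3 : z ^ n * h w = z ^ m * h w * (z ^ m)⁻¹ * z ^ n := by rw [← hnm]; group
    have h4 : (z ^ m)⁻¹ * z ^ n = z ^ n * (z ^ m)⁻¹ :=
      ((Commute.pow_pow_self z m n).inv_left).eq
    change h w * ((z ^ m)⁻¹ * z ^ n) = (z ^ m)⁻¹ * z ^ n * h w
    rw [mul_assoc _ (z ^ n), h3]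
    group

/-- The twist `w ↦ h w * z ^ (n * p w)` is multiplicative as `z` centralizes the image of that
vertex group, and it is unchanged on the edge group, where `p` vanishes. -/
theorem IsHyperbolicLength.exists_twist_amalgam_hom (H : IsHyperbolicLength ℓ δ)
    (tf : IsTorsionFreeGroup Γ) (S : AmalgamSplitting G) (i : Bool) (h : G →* Γ) {z : Γ}
    (hz : z ≠ 1) (hc : ∀ w ∈ S.vertex (!i), Commute (h w) z)
    (p : S.vertex (!i) →* Multiplicative ℤ)
    (hp : ∀ c (hc : c ∈ S.edge), p ⟨c, S.edge_le (!i) hc⟩ = 1) (hp' : ∃ w, p w ≠ 1) :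
    ∃ f, IsTwistSequence h (S.vertex i) f := by
  let β : S.vertex (!i) →* powerFunctions z :=
    { toFun := fun w => const z (h w) * gen z ^ (p w).toAdd
      map_one' := by simp
      map_mul' := fun a b => by
        have := ((commute_gen (hc b b.2)).zpow_right (p a).toAdd).eq
        simp only [Subgroup.coe_mul, map_mul, toAdd_mul, zpow_add]
        rw [mul_assoc, mul_assoc, ← mul_assoc (const z (h b)), this]
        simp only [mul_assoc] }
  obtain ⟨F, hF, hF'⟩ := S.exists_extension i (((const z).comp h).comp (S.vertex i).subtype) β
    fun c hcS => by
      change const z (h c) = const z (h c) * gen z ^ (p ⟨c, S.edge_le (!i) hcS⟩).toAdd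
      rw [hp c hcS]; simp
  obtain ⟨w, hw⟩ := hp'
  refine ⟨_, H.isTwistSequence tf hz F (S.hom_ext i (fun v hv => ?_) fun v hv => ?_)
    (fun v hv => hF ⟨v, hv⟩) ⟨w, fun n m hnm => ?_⟩⟩
  · rw [MonoidHom.comp_apply, hF ⟨v, hv⟩]; rfl
  · rw [MonoidHom.comp_apply, hF' ⟨v, hv⟩]; simp [β]
  · have hw0 : (p w).toAdd ≠ 0 := hw
    simp only [hF', β, MonoidHom.coe_mk, OneHom.coe_mk, map_mul, map_zpow, eval_const, eval_gen,
      mul_right_inj] at hnm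
    rw [← zpow_natCast, ← zpow_natCast, ← zpow_mul, ← zpow_mul] at hnm
    have := mul_right_cancel₀ hw0 (tf.zpow_injective hz hnm)
    exact_mod_cast this

end Twists

/-! ### Existence of twists and the theorem -/

section Main

variable {Γ G : Type*} [Group Γ] [Group G] {ℓ : Γ → ℕ} {δ : ℕ}

theorem IsHyperbolicLength.exists_twistSequence (H : IsHyperbolicLength ℓ δ)
    (tf : IsTorsionFreeGroup Γ) (nonelem : ¬ IsElementaryGroup Γ) [Group.FG G]
    {Θ : OneEdgeSplitting G} (hΘ : Θ.IsFree ∨ Θ.IsEssentialCyclic) {h : G →* Γ}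
    (hw : Θ.IsWitness h) {V : Subgroup G} (hV : V ∈ Θ.vertexGroups) :
    ∃ f, IsTwistSequence h V f := by
  have edge_free : Θ.edgeGroup = ⊥ → ∀ z : Γ, ∀ c ∈ Θ.edgeGroup, Commute (h c) z :=
    fun h0 z c hc => by
      rw [h0, Subgroup.mem_bot] at hc
      rw [hc, map_one]
      exact Commute.one_left z
  have edge_cyclic : Θ.edgeGroup ≠ ⊥ → Θ.IsEssential ∧ ∃ c ∈ Θ.edgeGroup, h c ≠ 1 ∧
      ∀ c' ∈ Θ.edgeGroup, ∃ n : ℤ, h c' = h c ^ n := fun h0 => by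
    obtain ⟨hcyc, hess⟩ := hΘ.resolve_left h0
    obtain ⟨⟨c, hc⟩, hgen⟩ := hcyc.exists_generator
    have hgen' : ∀ c' ∈ Θ.edgeGroup, ∃ n : ℤ, c' = c ^ n := fun c' hc' => by
      obtain ⟨n, hn⟩ := hgen ⟨c', hc'⟩
      exact ⟨n, (congrArg Subtype.val hn).symm⟩
    refine ⟨hess, c, hc, fun h1 => h0 ?_, fun c' hc' => ?_⟩
    · have hc1 : c = 1 := hw.injOn_edge hc (one_mem _) (by rw [h1, map_one])
      refine (Subgroup.eq_bot_iff_forall _).2 fun c' hc' => ?_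
      obtain ⟨n, hn⟩ := hgen' c' hc'
      rw [hn, hc1, one_zpow]
    · obtain ⟨n, hn⟩ := hgen' c' hc'
      exact ⟨n, by rw [hn, map_zpow]⟩
  cases Θ with
  | amalgam S =>
    obtain ⟨i, rfl⟩ := hV
    by_cases h0 : S.edge = ⊥
    -- With trivial edge group `z` is arbitrary, so it can be chosen not to commute with a
    -- non-trivial `h w`.
    · have hne := hw.vertex_nontrivial h0 _ ⟨!i, rfl⟩
      obtain ⟨⟨_, w, hwV, rfl⟩, hw1⟩ := Subgroup.ne_bot_iff_exists_ne_one.1 hne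
      have hw1 : h w ≠ 1 := fun h => hw1 (Subtype.ext h)
      obtain ⟨u, hu⟩ := H.not_central tf nonelem hw1
      exact H.exists_twist_amalgam_conj tf S i h (edge_free h0 u) hwV fun hc => hu hc.symm
    · obtain ⟨hess, c, hc, hc1, hgen⟩ := edge_cyclic h0
      by_cases hab : (S.vertex (!i)).IsNonabelian
      · obtain ⟨c', hc', w, hwV, hcw⟩ := hw.edge_noncentral _ ⟨!i, rfl⟩ hab h0
        refine H.exists_twist_amalgam_conj tf S i h (z := h c) (fun c'' hc'' => ?_) hwV
          fun hcomm => hcw ?_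
        · obtain ⟨n, hn⟩ := hgen c'' hc''
          rw [hn]
          exact Commute.zpow_self _ n
        · obtain ⟨n, hn⟩ := hgen c' hc'
          rw [hn]
          exact ((hcomm.zpow_right n).eq).symm
      -- Conjugation by `h c` would be trivial on an abelian vertex group, so a map to `ℤ` is used
      -- instead.
      · have hab' : ∀ x ∈ S.vertex (!i), ∀ y ∈ S.vertex (!i), x * y = y * x := by
          by_contra! hcon
          exact hab hcon
        obtain ⟨p, hp, hp'⟩ := S.exists_hom_int i hab' (hess (!i))
        refine H.exists_twist_amalgam_hom tf S i h hc1 (fun w hwV => ?_) p hp hp'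
        exact Commute.map (hab' w hwV c (S.edge_le _ hc)) h
  | hnn S =>
    obtain rfl : V = S.vertex := hV
    have hmem : ∀ c : S.edge, (c : G) ∈ S.edge.map S.vertex.subtype := fun c => ⟨c, c.2, rfl⟩
    by_cases h0 : S.edge.map S.vertex.subtype = ⊥
    · exact H.exists_twist_hnn tf S h (hw.stable_nontrivial h0 _ rfl)
        fun c => edge_free h0 _ c (hmem c)
    · obtain ⟨-, c, hc, hc1, hgen⟩ := edge_cyclic h0
      refine H.exists_twist_hnn tf S h hc1 fun c' => ?_
      obtain ⟨n, hn⟩ := hgen c' (hmem c')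
      rw [hn]
      exact Commute.zpow_self _ n

theorem OneEdgeSplitting.edgeGroup_le {Θ : OneEdgeSplitting G} {V : Subgroup G}
    (hV : V ∈ Θ.vertexGroups) : Θ.edgeGroup ≤ V := by
  cases Θ with
  | amalgam S =>
    obtain ⟨i, rfl⟩ := hV
    exact S.edge_le i
  | hnn S =>
    obtain rfl : V = S.vertex := hV
    exact Subgroup.map_subtype_le _

theorem OneEdgeSplitting.IsWitness.map_nonabelian {Θ : OneEdgeSplitting G} {h : G →* Γ}
    (hw : Θ.IsWitness h) {V : Subgroup G} (hV : V ∈ Θ.vertexGroups) (hab : V.IsNonabelian) :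
    (V.map h).IsNonabelian := by
  by_cases h0 : Θ.edgeGroup = ⊥
  · exact hw.vertex_nonabelian h0 V hV hab
  · obtain ⟨c, hc, a, ha, hca⟩ := hw.edge_noncentral V hV hab h0
    exact ⟨h c, ⟨c, OneEdgeSplitting.edgeGroup_le hV hc, rfl⟩, h a, ⟨a, ha, rfl⟩, hca⟩

/-- The terms of a twist sequence are pairwise non-conjugate if `h(V)` is non-abelian. -/
theorem IsTwistSequence.eq_of_conj {h : G →* Γ} {V : Subgroup G} {f : ℕ → G →* Γ}
    (hf : IsTwistSequence h V f) (H : IsHyperbolicLength ℓ δ) (tf : IsTorsionFreeGroup Γ)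
    (hab : (V.map h).IsNonabelian) {n m : ℕ} {γ : Γ} (hγ : ∀ g, f m g = γ * f n g * γ⁻¹) :
    n = m := by
  have hcomm : ∀ v ∈ V, Commute (h v) γ := fun v hv => by
    have := hγ v
    rw [hf.eqOn m v hv, hf.eqOn n v hv, eq_mul_inv_iff_mul_eq] at this
    exact this
  have h1 : γ = 1 := by
    by_contra hne
    obtain ⟨_, ⟨a, ha, rfl⟩, _, ⟨b, hb, rfl⟩, hab⟩ := hab
    exact hab (H.commute_trans tf hne (hcomm a ha) (hcomm b hb)).eq
  exact hf.injective (MonoidHom.ext fun g => by rw [hγ g, h1]; simp)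

/-- All but finitely many terms of a twist sequence satisfy finitely many inequations that hold
for `h`. -/
theorem IsTwistSequence.infinite_forall_ne_one {h : G →* Γ} {V : Subgroup G} {f : ℕ → G →* Γ}
    (hf : IsTwistSequence h V f) {α : Type*} {Λ : Set α} (hΛ : Λ.Finite) (w : α → G)
    (hw : ∀ a ∈ Λ, h (w a) ≠ 1) : {n | ∀ a ∈ Λ, f n (w a) ≠ 1}.Infinite := by
  have : ∀ᶠ n in Filter.atTop, ∀ a ∈ Λ, f n (w a) ≠ 1 :=
    (Filter.eventually_all_finite hΛ).2 fun a ha => hf.eventually_ne_one _ (hw a ha)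
  exact Nat.frequently_atTop_iff_infinite.1 this.frequently

open scoped Monoid.Coprod in
theorem map_evalWord {ι κ : Type*} (f : G →* Γ) (x : ι → G) (a : κ → G)
    (w : FreeGroup ι ∗ FreeGroup κ) :
    evalWord (fun i => f (x i)) (fun k => f (a k)) w = f (evalWord x a w) := by
  have : Monoid.Coprod.lift (FreeGroup.lift fun i => f (x i)) (FreeGroup.lift fun k => f (a k)) =
      f.comp (Monoid.Coprod.lift (FreeGroup.lift x) (FreeGroup.lift a)) := by
    ext <;> simp
  exact DFunLike.congr_fun this w

theorem map_freeGroup_lift {ι : Type*} (f : G →* Γ) (x : ι → G) (w : FreeGroup ι) :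
    FreeGroup.lift (fun i => f (x i)) w = f (FreeGroup.lift x w) := by
  have : FreeGroup.lift (fun i => f (x i)) = f.comp (FreeGroup.lift x) := by ext; simp
  exact DFunLike.congr_fun this w

end Main

open scoped Monoid.Coprod in
theorem propositionp {Γ : Type*} [Group Γ] (hyp : IsHyperbolicGroup Γ)
    (tf : IsTorsionFreeGroup Γ) (nonelem : ¬ IsElementaryGroup Γ)
    {G : Type*} [Group G] (Θ : OneEdgeSplitting G) (hΘ : Θ.IsNontrivial)
    (hΘ' : Θ.IsFree ∨ Θ.IsEssentialCyclic) :
    -- with coefficients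
    (∀ {ι κ : Type*} [Finite ι] [Finite κ] (x : ι → G) (a : κ → G)
      (Λ : Set (FreeGroup ι ∗ FreeGroup κ)) (h : G →* Γ),
      Subgroup.closure (Set.range x ∪ Set.range a) = ⊤ →
      Θ.IsElliptic (Subgroup.closure (Set.range a)) →
      Λ.Finite →
      Θ.IsWitness h →
      (Subgroup.closure (Set.range a)).map h = ⊤ →
      (∀ w ∈ Λ, evalWord (fun i => h (x i)) (fun k => h (a k)) w ≠ 1) →
      (IHomCoeff x a (fun k => h (a k)) Λ).Infinite) ∧
    -- without coefficients
    (∀ {ι : Type*} [Finite ι] (x : ι → G) (Λ : Set (FreeGroup ι)) (h : G →* Γ),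
      Subgroup.closure (Set.range x) = ⊤ →
      (∃ A ∈ Θ.vertexGroups, A.IsNonabelian) →
      Λ.Finite →
      Θ.IsWitness h →
      (∀ w ∈ Λ, FreeGroup.lift (fun i => h (x i)) w ≠ 1) →
      Infinite (IHomClasses Γ x Λ)) := by
  obtain ⟨ℓ, δ, H⟩ := hyp.exists_length
  constructor
  · intro ι κ _ _ x a Λ h hgen hell hΛ hw _ hne
    have hfg : Group.FG G := Group.fg_iff.2
      ⟨_, hgen, (Set.finite_range x).union (Set.finite_range a)⟩
    obtain ⟨V, hV, g, hg⟩ := hell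
    obtain ⟨f, hf⟩ := H.exists_twistSequence tf nonelem hΘ' hw hV
    simp only [map_evalWord] at hne
    have hinf := hf.infinite_forall_ne_one hΛ (evalWord x a) hne
    -- This conjugation makes `F n` agree with `h` on the conjugate of `V` by `g`, which contains
    -- the coefficients.
    let F : ℕ → G →* Γ := fun n => (MulAut.conj (h g * (f n g)⁻¹)).toMonoidHom.comp (f n)
    have hF : ∀ n y, F n y = h g * (f n g)⁻¹ * f n y * (h g * (f n g)⁻¹)⁻¹ := fun n y => rfl
    have hFinj : Function.Injective F := fun n m hnm => by
      refine hf.injective (MonoidHom.ext fun y => ?_)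
      -- On such conjugates the factor `f k g` cancels, so `F k` determines `f k`.
      have h1 : ∀ k, F k (g * y * g⁻¹) = h g * f k y * (h g)⁻¹ := fun k => by
        rw [hF, map_mul, map_mul, map_inv]; group
      have h2 : F n (g * y * g⁻¹) = F m (g * y * g⁻¹) := by rw [hnm]
      rw [h1, h1] at h2
      exact mul_left_cancel (mul_right_cancel h2)
    refine (hinf.image hFinj.injOn).mono ?_
    rintro _ ⟨n, hn, rfl⟩
    refine ⟨fun k => ?_, fun w hwΛ => ?_⟩
    · obtain ⟨v, hv, hvk⟩ := hg (Subgroup.subset_closure ⟨k, rfl⟩)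
      have hvk' : a k = g * v * g⁻¹ := hvk.symm
      change F n (a k) = h (a k)
      rw [hF, hvk', map_mul, map_mul, map_inv, hf.eqOn n v hv, map_mul, map_mul, map_inv]
      group
    · rw [map_evalWord, hF]
      exact fun h1 => hn w hwΛ (conj_eq_one_iff.1 h1)
  · intro ι _ x Λ h hgen hA hΛ hw hne
    have hfg : Group.FG G := Group.fg_iff.2 ⟨_, hgen, Set.finite_range x⟩
    obtain ⟨V, hV, hab⟩ := hA
    obtain ⟨f, hf⟩ := H.exists_twistSequence tf nonelem hΘ' hw hV
    simp only [map_freeGroup_lift] at hne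
    have hinf := hf.infinite_forall_ne_one hΛ (FreeGroup.lift x) hne
    have := hinf.to_subtype
    have hmem : ∀ n : {n | ∀ w ∈ Λ, f n (FreeGroup.lift x w) ≠ 1}, f n ∈ IHom Γ x Λ :=
      fun n w hwΛ => by rw [map_freeGroup_lift]; exact n.2 w hwΛ
    refine Infinite.of_injective (fun n : {n | ∀ w ∈ Λ, f n (FreeGroup.lift x w) ≠ 1} =>
      (Quotient.mk (IHom.conjSetoid Γ x Λ) ⟨f n, hmem n⟩ : IHomClasses Γ x Λ)) fun n m hnm => ?_
    obtain ⟨γ, hγ⟩ := Quotient.exact hnm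
    exact Subtype.ext (hf.eq_of_conj H tf (hw.map_nonabelian hV hab) hγ)
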